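/- Let $a$ and $b$ be positive odd integers such that $b$ divides $a$ and $a\ge 5b$, and let $\mathcal E=\{1,3,5,\dots,b\}$. For real $r>0$ put $$Q(X)=(X+2r+1)^b(X-1)^{a+b}-(X-2r-1)^b(X+1)^{a+b},$$ and, for $\tau\in\mathbb C\setminus((-\infty,1]\cup[2r+1,+\infty))$, $$f(\tau)=b(\tau+2r+1)\log(\tau+2r+1)+b(2r+1-\tau)\log(2r+1-\tau)+(a+b)(\tau-1)\log(\tau-1)-(a+b)(\tau+1)\log(\tau+1)+2(a-2br)\log 2,$$ $$g(\tau)=\frac{(\tau+2r+1)^{b/2}(2r+1-\tau)^{b/2}}{(\tau+1)^{(a+b)/2}(\tau-1)^{(a+b)/2}},$$ where the logarithms and powers are the determinations that are real, respectively positive, for $\tau\in(1,2r+1)$. Then there exists a finite set $\mathcal R_{a,b}$ of real numbers, depending only on $a$ and $b$, such that for every real number $r$ with $1\le r\le\frac{a-1}{3b}$ and $r\notin\mathcal R_{a,b}$ the following holds. The polynomial $Q$ has exactly one root $\mu_1$ in $(2r+1,+\infty)$, and exactly $(b-1)/2$ distinct roots in the domain $\operatorname{Re} z>0$, $\operatorname{Im}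 z>0$, with pairwise distinct real parts; denote the latter by $\varrho_1,\varrho_3,\dots,\varrho_{b-2}$ with $\operatorname{Re}\varrho_1<\operatorname{Re}\varrho_3<\dots<\operatorname{Re}\varrho_{b-2}$, and let $\varrho_b=\mu_1+i0$ be the point $\mu_1$ on the upper bank of the cut $[2r+1,+\infty)$, where values of $f''$ and $g$ are understood as limits from the upper half-plane. For every $\lambda\in\mathcal E$, $$-\tfrac12\arg f''(\varrho_\lambda)+\arg g(\varrho_\lambda)\not\equiv\frac{\pi}{2}\pmod{\pi}.$$ -/

import Mathlib

open Polynomial Filter Topology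

noncomputable section

namespace SaddlePhase

/-- The index set `{1, 3, 5, …, b}` of odd integers between `1` and `b`. -/
def oddUpTo (b : ℕ) : Finset ℕ := (Finset.Icc 1 b).filter Odd

/-- The polynomial `(X+2r+1)^b (X-1)^(a+b) - (X-2r-1)^b (X+1)^(a+b)`. -/
def Q (a b : ℕ) (r : ℝ) : ℂ[X] :=
  (X + C (2 * (r : ℂ) + 1)) ^ b * (X - 1) ^ (a + b)
    - (X - C (2 * (r : ℂ) + 1)) ^ b * (X + 1) ^ (a + b)

/-- The phase function `f` on the complex plane cut along `(-∞, 1]` and `[2r+1, +∞)`.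
All logarithms are principal: on this domain these are the determinations that are real on
the interval `(1, 2r+1)`. -/
def f (a b : ℕ) (r : ℝ) (τ : ℂ) : ℂ :=
  b * (τ + 2 * r + 1) * Complex.log (τ + 2 * r + 1)
    + b * (2 * r + 1 - τ) * Complex.log (2 * r + 1 - τ)
    + (a + b) * (τ - 1) * Complex.log (τ - 1)
    - (a + b) * (τ + 1) * Complex.log (τ + 1)
    + 2 * (a - 2 * b * r) * Complex.log 2

/-- The amplitude `g` on the same cut plane (principal powers, positive on `(1, 2r+1)`). -/
def g (a b : ℕ) (r : ℝ) (τ : ℂ) : ℂ :=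
  ((τ + 2 * r + 1) ^ ((b : ℂ) / 2) * (2 * r + 1 - τ) ^ ((b : ℂ) / 2))
    / ((τ + 1) ^ (((a : ℂ) + b) / 2) * (τ - 1) ^ (((a : ℂ) + b) / 2))

/-- `F (z + i0)`, the limit of `F (z + i ε)` as `ε` decreases to `0`. At a point of a cut this is
the value on the upper bank; at a point of continuity of `F` it is `F z`
(see `upperValue_eq`). -/
def upperValue (F : ℂ → ℂ) (z : ℂ) : ℂ :=
  limUnder (𝓝[>] (0 : ℝ)) (fun ε : ℝ => F (z + ε * Complex.I))

theorem upperValue_eq {F : ℂ → ℂ} {z : ℂ} (h : ContinuousAt F z) : upperValue F z = F z := by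
  apply Tendsto.limUnder_eq
  have h1 : Tendsto (fun ε : ℝ => z + ε * Complex.I) (𝓝 0) (𝓝 z) := by
    have : Continuous (fun ε : ℝ => z + ε * Complex.I) := by fun_prop
    simpa using this.tendsto 0
  exact h.tendsto.comp (h1.mono_left nhdsWithin_le_nhds)

/-- `ρ` lists the saddle points `ρ 1, ρ 3, …, ρ b`: those with index `< b` are exactly the roots
of `Q` in the open first quadrant, in strictly increasing order of real parts, and `ρ b` is the
unique real root of `Q` larger than `2r+1` (to be taken on the upper bank of the cut). -/
structure IsSaddleFamily (a b : ℕ) (r : ℝ) (ρ : ℕ → ℂ) : Prop where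
  strictMono_re : StrictMonoOn (fun l => (ρ l).re) {l | l ∈ oddUpTo b ∧ l < b}
  image_eq : ρ '' {l | l ∈ oddUpTo b ∧ l < b} =
    {z : ℂ | 0 < z.re ∧ 0 < z.im ∧ (Q a b r).IsRoot z}
  last_eq : ∃ μ : ℝ, 2 * r + 1 < μ ∧ (Q a b r).IsRoot (μ : ℂ) ∧
    (∀ ν : ℝ, 2 * r + 1 < ν → (Q a b r).IsRoot (ν : ℂ) → ν = μ) ∧ ρ b = (μ : ℂ)

/-- The phase `-½ arg f''(z) + arg g(z)`, read at `z + i0`. -/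
def phase (a b : ℕ) (r : ℝ) (z : ℂ) : ℝ :=
  -(1 / 2) * (upperValue (deriv (deriv (f a b r))) z).arg + (upperValue (g a b r) z).arg

end SaddlePhase

end

/-! Write `M = (a + b) / b`, an even integer, and `α = r / (r + 1)`. The Möbius map `u = (z - 1) /
(z + 1)` sends the right half plane to the unit disc and turns `Q = 0` into `u - α = ζ u ^ M (1 - α
u)`, with `ζ` running over the `b`-th roots of unity.

For `|ζ| = 1` and `|α| < (M - 1) / (M + 1)` this equation has exactly one root in the disc.
Uniqueness is a Hilbert space argument: the vectors `((1 - α u) u ^ j)`, `j < M`, attached to roots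
have all mutual inner products equal to `1 - α ^ 2` (`IsDiscRoot.sum_mul_conj`), so they coincide.
The same identity yields the bound `IsDiscRoot.norm_lt`. Existence comes from Gauss–Lucas
(`exists_isDiscRoot`). Thus the saddles in the right half plane are indexed by `ζ`; `ζ = 1` gives
the real one, and complex conjugation pairs the others.

The phase is `π / 2` modulo `π` only if `g ^ 2 * conj f''` is a nonpositive real, that is, only if
`phaseTest` is a nonnegative real. For `ζ = 1`, `IsDiscRoot.norm_lt` makes `phaseTest` negative for
every admissible `r`. For `ζ ≠ 1`, `Im phaseTest` is real analytic in `α` and equivalent to `-Im ζ *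
α ^ M` at `0`, so it has finitely many zeros on a compact parameter interval. Differences of real
parts of saddles are treated likewise, with leading term `2 (Re ζ - Re ζ') α ^ M`. These finitely
many zeros form the exceptional set. -/

namespace SaddlePhase

/-! ### Uniqueness and simplicity of the root in the disc -/

/-- `u` is a root in the unit disc of `u - α = ζ u ^ M (1 - α u)`. -/
def IsDiscRoot (M : ℕ) (ζ : ℂ) (α : ℝ) (u : ℂ) : Prop :=
  ‖u‖ < 1 ∧ u - α = ζ * u ^ M * (1 - α * u)

theorem one_sub_mul_ne_zero {z w : ℂ} (hz : ‖z‖ < 1) (hw : ‖w‖ < 1) : 1 - z * w ≠ 0 := by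
  intro h
  have h1 : ‖z * w‖ = 1 := by rw [← sub_eq_zero.mp h, norm_one]
  rw [norm_mul] at h1
  nlinarith [norm_nonneg z, norm_nonneg w]

theorem mul_conj_eq_one {ζ : ℂ} (hζ : ‖ζ‖ = 1) : ζ * (starRingEnd ℂ) ζ = 1 := by
  rw [Complex.mul_conj, Complex.normSq_eq_norm_sq, hζ]; simp

/-- AM-GM on the terms `j` and `M - 1 - j`, whose product is `x ^ (2 * (M - 1))`; the pair at `j =
0` is strict. -/
theorem mul_pow_lt_sum_pow {M : ℕ} {x : ℝ} (hM : 2 ≤ M) (h0 : 0 ≤ x) (h1 : x < 1) :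
    M * x ^ (M - 1) < ∑ j ∈ Finset.range M, x ^ (2 * j) := by
  have h2 : 2 * ∑ j ∈ Finset.range M, x ^ (2 * j) =
      ∑ j ∈ Finset.range M, (x ^ (2 * j) + x ^ (2 * (M - 1 - j))) := by
    rw [Finset.sum_add_distrib, Finset.sum_range_reflect (fun j => x ^ (2 * j)) M]; ring
  have key : ∀ j ∈ Finset.range M,
      x ^ (2 * j) + x ^ (2 * (M - 1 - j)) - 2 * x ^ (M - 1) = (x ^ j - x ^ (M - 1 - j)) ^ 2 := by
    intro j hj
    have hj' := Finset.mem_range.mp hj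
    have : x ^ (M - 1) = x ^ j * x ^ (M - 1 - j) := by rw [← pow_add]; congr 1; omega
    rw [this, pow_mul', pow_mul']; ring
  have h3 : ∑ j ∈ Finset.range M, 2 * x ^ (M - 1) <
      ∑ j ∈ Finset.range M, (x ^ (2 * j) + x ^ (2 * (M - 1 - j))) := by
    refine Finset.sum_lt_sum (fun j hj => ?_) ⟨0, Finset.mem_range.mpr (by omega), ?_⟩
    · nlinarith [key j hj, sq_nonneg (x ^ j - x ^ (M - 1 - j))]
    · have hk := key 0 (Finset.mem_range.mpr (by omega))
      have hx : x ^ (M - 1) < 1 := pow_lt_one₀ h0 h1 (by omega)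
      have : 0 < (x ^ 0 - x ^ (M - 1 - 0)) ^ 2 := by
        simp only [pow_zero, Nat.sub_zero]
        have : 0 < 1 - x ^ (M - 1) := by linarith
        positivity
      linarith
  rw [← h2, Finset.sum_const, Finset.card_range, nsmul_eq_mul] at h3
  linarith

namespace IsDiscRoot

variable {M : ℕ} {ζ : ℂ} {α : ℝ} {u v : ℂ}

theorem one_sub_ne_zero (hu : IsDiscRoot M ζ α u) (hα : |α| < 1) : 1 - (α : ℂ) * u ≠ 0 :=
  one_sub_mul_ne_zero (by simpa using hα) hu.1

/-- With `w = conj v`, multiplying the equation of `u` by the conjugate of that of `v` eliminates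
`ζ`. The geometric sum then collapses through `(1 - α u)(1 - α w) - (u - α)(w - α) = (1 - α ^ 2)(1 -
u w)`. -/
theorem sum_mul_conj (hζ : ‖ζ‖ = 1) (hu : IsDiscRoot M ζ α u) (hv : IsDiscRoot M ζ α v) :
    ∑ j ∈ Finset.range M, ((1 - α * u) * u ^ j) * (starRingEnd ℂ) ((1 - α * v) * v ^ j) =
      1 - (α : ℂ) ^ 2 := by
  set w := (starRingEnd ℂ) v with hw
  have hne : 1 - u * w ≠ 0 := one_sub_mul_ne_zero hu.1 (by simpa [hw] using hv.1)
  have h1 : ∑ j ∈ Finset.range M, ((1 - α * u) * u ^ j) * (starRingEnd ℂ) ((1 - α * v) * v ^ j) =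
      (1 - α * u) * (1 - α * w) * ∑ j ∈ Finset.range M, (u * w) ^ j := by
    rw [Finset.mul_sum]
    refine Finset.sum_congr rfl fun j _ => ?_
    simp only [map_mul, map_sub, map_one, map_pow, Complex.conj_ofReal, ← hw]
    ring
  have h2 : w - α = (starRingEnd ℂ) ζ * w ^ M * (1 - α * w) := by
    simpa [← hw] using congrArg (starRingEnd ℂ) hv.2
  have h3 : (1 - u * w) * ∑ j ∈ Finset.range M, (u * w) ^ j = 1 - (u * w) ^ M :=
    mul_neg_geom_sum _ _
  have h4 : (u - α) * (w - α) = (u * w) ^ M * ((1 - α * u) * (1 - α * w)) := by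
    rw [hu.2, h2]
    linear_combination (u ^ M * w ^ M * (1 - α * u) * (1 - α * w)) * mul_conj_eq_one hζ
  rw [h1]
  apply mul_left_cancel₀ hne
  linear_combination ((1 - α * u) * (1 - α * w)) * h3 + h4

/-- The vectors of `u` and `v` have difference of squared norm `c - c - c + c = 0`, where `c = 1 - α
^ 2`. The components `j = 0` and `j = 1` then recover the root. -/
theorem unique (hM : 2 ≤ M) (hζ : ‖ζ‖ = 1) (hα : |α| < 1) (hu : IsDiscRoot M ζ α u)
    (hv : IsDiscRoot M ζ α v) : u = v := by
  set p : ℕ → ℂ := fun j => (1 - α * u) * u ^ j with hp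
  set q : ℕ → ℂ := fun j => (1 - α * v) * v ^ j with hq
  have h0 : ∑ j ∈ Finset.range M, (p j - q j) * (starRingEnd ℂ) (p j - q j) = 0 := by
    have : ∀ j, (p j - q j) * (starRingEnd ℂ) (p j - q j) =
        p j * (starRingEnd ℂ) (p j) - p j * (starRingEnd ℂ) (q j)
          - q j * (starRingEnd ℂ) (p j) + q j * (starRingEnd ℂ) (q j) := by
      intro j; rw [map_sub]; ring
    rw [Finset.sum_congr rfl fun j _ => this j]
    simp only [Finset.sum_add_distrib, Finset.sum_sub_distrib, hp, hq,
      sum_mul_conj hζ hu hu, sum_mul_conj hζ hu hv, sum_mul_conj hζ hv hu, sum_mul_conj hζ hv hv]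
    ring
  have h1 : ∑ j ∈ Finset.range M, ‖p j - q j‖ ^ 2 = 0 := by
    have : ((∑ j ∈ Finset.range M, ‖p j - q j‖ ^ 2 : ℝ) : ℂ) = 0 := by
      rw [← h0]; push_cast
      exact Finset.sum_congr rfl fun j _ => (Complex.mul_conj' _).symm
    exact_mod_cast this
  have h2 : ∀ j < M, p j = q j := by
    intro j hj
    have := (Finset.sum_eq_zero_iff_of_nonneg (fun i _ => by positivity)).mp h1 j
      (Finset.mem_range.mpr hj)
    rw [sq_eq_zero_iff, norm_eq_zero] at this
    exact sub_eq_zero.mp this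
  have e0 := h2 0 (by omega)
  have e1 := h2 1 (by omega)
  simp only [hp, hq, pow_zero, mul_one, pow_one] at e0 e1
  rw [e0] at e1
  exact mul_left_cancel₀ (hv.one_sub_ne_zero hα) e1

/-- The diagonal case of `sum_mul_conj`, with the sum bounded below by `mul_pow_lt_sum_pow`. It
shows that the root is simple and fixes the sign of `phaseTest` at the real saddle. -/
theorem norm_lt (hM : 2 ≤ M) (hζ : ‖ζ‖ = 1) (hα : |α| < 1) (hu : IsDiscRoot M ζ α u) :
    M * ‖u‖ ^ (M - 1) * ‖1 - (α : ℂ) * u‖ ^ 2 < 1 - α ^ 2 := by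
  have h : ∑ j ∈ Finset.range M, ‖1 - (α : ℂ) * u‖ ^ 2 * ‖u‖ ^ (2 * j) = 1 - α ^ 2 := by
    have h1 := sum_mul_conj hζ hu hu
    have : ((∑ j ∈ Finset.range M, ‖1 - (α : ℂ) * u‖ ^ 2 * ‖u‖ ^ (2 * j) : ℝ) : ℂ) =
        ((1 - α ^ 2 : ℝ) : ℂ) := by
      push_cast
      rw [← h1]
      refine Finset.sum_congr rfl fun j _ => ?_
      rw [Complex.mul_conj', norm_mul, norm_pow]
      push_cast; ring
    exact_mod_cast this
  rw [← Finset.mul_sum] at h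
  have h2 := mul_pow_lt_sum_pow hM (norm_nonneg u) hu.1
  have h3 : 0 < ‖1 - (α : ℂ) * u‖ ^ 2 := by
    have := norm_pos_iff.mpr (hu.one_sub_ne_zero hα); positivity
  rw [← h, mul_comm]
  exact mul_lt_mul_of_pos_left h2 h3

theorem ne_zero_of_ne (h : α ≠ 0) (hM : M ≠ 0) (hu : IsDiscRoot M ζ α u) : u ≠ 0 := by
  rintro rfl
  have := hu.2
  simp [hM, h] at this

/-- The `u`-derivative of `u - α - ζ u ^ M (1 - α u)` does not vanish at a root, up to the factor
`1 - α u`. -/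
theorem derivative_ne_zero (hM : 2 ≤ M) (hζ : ‖ζ‖ = 1) (hα : |α| < 1) (hu : IsDiscRoot M ζ α u) :
    M * ζ * u ^ (M - 1) * (1 - α * u) ^ 2 - (1 - (α : ℂ) ^ 2) ≠ 0 := by
  intro h
  have h1 := hu.norm_lt hM hζ hα
  have h2 : ‖(M : ℂ) * ζ * u ^ (M - 1) * (1 - α * u) ^ 2‖ = 1 - α ^ 2 := by
    rw [sub_eq_zero.mp h]
    have : (1 - (α : ℂ) ^ 2) = ((1 - α ^ 2 : ℝ) : ℂ) := by push_cast; ring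
    rw [this, Complex.norm_real, Real.norm_of_nonneg]
    nlinarith [sq_abs α, abs_nonneg α]
  simp only [norm_mul, norm_pow, hζ, Complex.norm_natCast, mul_one] at h2
  linarith

end IsDiscRoot

/-! ### Existence of the root in the disc -/

/-- The polynomial whose roots in the unit disc are described by `IsDiscRoot`. -/
noncomputable def discPoly (M : ℕ) (ζ : ℂ) (α : ℝ) : ℂ[X] :=
  X - C (α : ℂ) - C ζ * X ^ M * (1 - C (α : ℂ) * X)

section

variable {M : ℕ} {ζ : ℂ} {α : ℝ}

theorem eval_discPoly (u : ℂ) :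
    (discPoly M ζ α).eval u = u - α - ζ * u ^ M * (1 - α * u) := by
  simp [discPoly]

theorem eval_derivative_discPoly (hM : 1 ≤ M) (u : ℂ) : (discPoly M ζ α).derivative.eval u =
    1 - M * ζ * u ^ (M - 1) + (M + 1) * α * ζ * u ^ M := by
  have : u ^ M = u ^ (M - 1) * u := by rw [← pow_succ]; congr 1; omega
  simp [discPoly, derivative_X_pow]
  rw [this]; ring

/-- The roots of `discPoly` are symmetric with respect to the unit circle. -/
theorem isRoot_discPoly_inv_conj (hζ : ‖ζ‖ = 1) {u : ℂ} (hu0 : u ≠ 0)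
    (hu : (discPoly M ζ α).IsRoot u) : (discPoly M ζ α).IsRoot ((starRingEnd ℂ) u)⁻¹ := by
  rw [IsRoot.def, eval_discPoly] at hu ⊢
  set w := (starRingEnd ℂ) u with hw
  have hw0 : w ≠ 0 := by simpa [hw] using hu0
  have h2 : w - α - (starRingEnd ℂ) ζ * w ^ M * (1 - α * w) = 0 := by
    simpa [← hw] using congrArg (starRingEnd ℂ) hu
  have h3 : w⁻¹ - α - ζ * w⁻¹ ^ M * (1 - α * w⁻¹) =
      -ζ * w⁻¹ ^ (M + 1) * (w - α - (starRingEnd ℂ) ζ * w ^ M * (1 - α * w)) := by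
    have h4 : w⁻¹ ^ M * w ^ M = 1 := by rw [← mul_pow, inv_mul_cancel₀ hw0, one_pow]
    have h5 : w⁻¹ * w = 1 := inv_mul_cancel₀ hw0
    have h6 := mul_conj_eq_one hζ
    rw [pow_succ]
    linear_combination (-(1 - α * w) * w⁻¹ * w⁻¹ ^ M * w ^ M) * h6
      - (1 - α * w) * w⁻¹ * h4 + (ζ * w⁻¹ ^ M + α) * h5
  rw [h3, h2, mul_zero]

/-- In terms of `v = 1 / w` the critical equation reads `M v = conj ζ * v ^ M + (M + 1) α`, a fixed
point problem. The bound on `α` is exactly `ρ < 1`, and the map contracts the ball of radius `ρ`.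
Since `α ≠ 0`, the fixed point is nonzero. -/
theorem exists_derivative_root (hM : 2 ≤ M) (hζ : ‖ζ‖ = 1) (hα0 : α ≠ 0)
    (hα : (M + 1) * |α| < M - 1) :
    ∃ w : ℂ, 1 < ‖w‖ ∧ (discPoly M ζ α).derivative.IsRoot w := by
  have hM0 : (0 : ℝ) < M := by positivity
  set ρ : ℝ := (1 + (M + 1) * |α|) / M with hρ
  have hρ0 : 0 < ρ := by positivity
  have hρ1 : ρ < 1 := by rw [hρ, div_lt_one hM0]; linarith
  set T : ℂ → ℂ := fun v => ((starRingEnd ℂ) ζ * v ^ M + (M + 1) * α) / M with hT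
  have hmaps : Set.MapsTo T (Metric.closedBall 0 ρ) (Metric.closedBall 0 ρ) := by
    intro v hv
    simp only [mem_closedBall_zero_iff] at hv ⊢
    simp only [hT, norm_div, Complex.norm_natCast]
    rw [hρ]
    gcongr
    calc _ ≤ ‖(starRingEnd ℂ) ζ * v ^ M‖ + ‖((M : ℂ) + 1) * α‖ := norm_add_le _ _
      _ ≤ 1 + (M + 1) * |α| := by
        gcongr
        · rw [norm_mul, norm_pow, RCLike.norm_conj, hζ, one_mul]
          exact pow_le_one₀ (norm_nonneg _) (hv.trans hρ1.le)
        · rw [norm_mul, Complex.norm_real, Real.norm_eq_abs]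
          gcongr
          have : ((M : ℂ) + 1) = ((M + 1 : ℕ) : ℂ) := by push_cast; ring
          rw [this, Complex.norm_natCast]; push_cast; rfl
  have hlip : LipschitzOnWith ρ.toNNReal T (Metric.closedBall 0 ρ) := by
    refine (convex_closedBall (0 : ℂ) ρ).lipschitzOnWith_of_nnnorm_hasDerivWithin_le
      (f' := fun v => (starRingEnd ℂ) ζ * (M * v ^ (M - 1)) / M) ?_ ?_
    · intro v _
      exact ((((hasDerivAt_pow M v).const_mul _).add_const _).div_const _).hasDerivWithinAt
    · intro v hv
      simp only [mem_closedBall_zero_iff] at hv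
      rw [← NNReal.coe_le_coe, coe_nnnorm, Real.coe_toNNReal _ hρ0.le, norm_div, norm_mul,
        RCLike.norm_conj, hζ, norm_mul, Complex.norm_natCast, norm_pow, one_mul,
        mul_div_cancel_left₀ _ hM0.ne']
      calc ‖v‖ ^ (M - 1) ≤ ‖v‖ ^ 1 :=
            pow_le_pow_of_le_one (norm_nonneg _) (hv.trans hρ1.le) (by omega)
        _ ≤ ρ := by simpa using hv
  have hcontr : ContractingWith ρ.toNNReal (hmaps.restrict T _ _) :=
    ⟨by rw [← NNReal.coe_lt_coe, Real.coe_toNNReal _ hρ0.le]; exact_mod_cast hρ1,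
      hlip.mapsToRestrict hmaps⟩
  obtain ⟨v, hv, hfix, -⟩ := hcontr.exists_fixedPoint' (x := 0)
    (Metric.isClosed_closedBall.isComplete) hmaps (by simpa using hρ0.le) (edist_ne_top _ _)
  have hv' : ((starRingEnd ℂ) ζ * v ^ M + (M + 1) * α) = M * v := by
    have h : T v = v := hfix
    have hM0' : (M : ℂ) ≠ 0 := by exact_mod_cast hM0.ne'
    rw [(div_eq_iff hM0').mp h, mul_comm]
  have hv0 : v ≠ 0 := by
    rintro rfl
    have h1 : ((M : ℂ) + 1) ≠ 0 := by exact_mod_cast Nat.succ_ne_zero M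
    have : M ≠ 0 := by omega
    simp [this, h1, hα0] at hv'
  refine ⟨v⁻¹, ?_, ?_⟩
  · rw [norm_inv]
    apply one_lt_inv_iff₀.mpr
    exact ⟨norm_pos_iff.mpr hv0, lt_of_le_of_lt (by simpa using hv) hρ1⟩
  · rw [IsRoot.def, eval_derivative_discPoly (by omega)]
    have h4 : v⁻¹ ^ M * v ^ M = 1 := by rw [← mul_pow, inv_mul_cancel₀ hv0, one_pow]
    have h5 : v⁻¹ ^ M * v = v⁻¹ ^ (M - 1) := by
      have : v⁻¹ ^ M = v⁻¹ ^ (M - 1) * v⁻¹ := by rw [← pow_succ]; congr 1; omega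
      rw [this, mul_assoc, inv_mul_cancel₀ hv0, mul_one]
    linear_combination (-ζ * (starRingEnd ℂ) ζ) * h4 - mul_conj_eq_one hζ + (M * ζ) * h5
      + ζ * v⁻¹ ^ M * hv'

/-- Without a root in the open disc, symmetry in the unit circle puts every root on the circle. By
Gauss–Lucas all critical points then lie in the closed disc, contradicting `exists_derivative_root`.
-/
theorem exists_isDiscRoot (hM : 2 ≤ M) (hζ : ‖ζ‖ = 1) (hα : (M + 1) * |α| < M - 1) :
    ∃ u, IsDiscRoot M ζ α u := by
  rcases eq_or_ne α 0 with rfl | hα0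
  · exact ⟨0, by simp, by simp [show M ≠ 0 by omega]⟩
  by_contra! hno
  obtain ⟨w, hw, hroot⟩ := exists_derivative_root hM hζ hα0 hα
  have hroot_iff : ∀ u, (discPoly M ζ α).IsRoot u ↔ u - α = ζ * u ^ M * (1 - α * u) := by
    intro u; rw [IsRoot.def, eval_discPoly, sub_eq_zero]
  have hge : ∀ u, (discPoly M ζ α).IsRoot u → 1 ≤ ‖u‖ := by
    intro u hu
    by_contra! h
    exact hno u ⟨h, (hroot_iff u).mp hu⟩
  have hle : ∀ u, (discPoly M ζ α).IsRoot u → ‖u‖ ≤ 1 := by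
    intro u hu
    have h0 : u ≠ 0 := by
      rintro rfl
      have := hge 0 hu; norm_num at this
    have := hge _ (isRoot_discPoly_inv_conj hζ h0 hu)
    rw [norm_inv, RCLike.norm_conj] at this
    exact (one_le_inv₀ (norm_pos_iff.mpr h0)).mp this
  have hne : (discPoly M ζ α).derivative ≠ 0 := by
    intro h
    have h1 := eval_derivative_discPoly (ζ := ζ) (α := α) (M := M) (by omega) 0
    rw [h] at h1
    simp [show M ≠ 0 by omega, show M - 1 ≠ 0 by omega] at h1
  have hdeg : 0 < (discPoly M ζ α).degree := by
    by_contra h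
    rw [eq_C_of_degree_le_zero (not_lt.mp h)] at hne
    simp at hne
  have h1 := rootSet_derivative_subset_convexHull_rootSet hdeg
    (show w ∈ (discPoly M ζ α).derivative.rootSet ℂ by
      rw [mem_rootSet]; exact ⟨hne, by simpa using hroot⟩)
  have h2 : convexHull ℝ ((discPoly M ζ α).rootSet ℂ) ⊆ Metric.closedBall 0 1 := by
    refine convexHull_min (fun u hu => ?_) (convex_closedBall _ _)
    rw [mem_rootSet] at hu
    simpa using hle u (by simpa using hu.2)
  have := h2 h1
  simp only [mem_closedBall_zero_iff] at this
  linarith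

end

/-! ### Analytic dependence on the parameter, and behaviour at zero -/

/-- The root of `u - α = ζ u ^ M (1 - α u)` in the unit disc. -/
noncomputable def discRoot (M : ℕ) (ζ : ℂ) (α : ℝ) : ℂ := Classical.epsilon (IsDiscRoot M ζ α)

/-- The radius of the parameter interval in which the root in the unit disc is studied. -/
noncomputable def paramRadius (M : ℕ) : ℝ := (M - 1) / (M + 1)

/-- The inverse of the map sending a point of the right half plane to the unit disc. -/
noncomputable def toHalfPlane (u : ℂ) : ℂ := (1 + u) / (1 - u)

section

theorem one_sub_ne_zero_of_norm_lt_one {z : ℂ} (hz : ‖z‖ < 1) : 1 - z ≠ 0 := by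
  intro h
  rw [← sub_eq_zero.mp h, norm_one] at hz
  exact lt_irrefl _ hz

variable {M : ℕ} {ζ : ℂ} {α : ℝ}

theorem mul_abs_lt_of_abs_lt (h : |α| < paramRadius M) : (M + 1) * |α| < M - 1 := by
  have : (0 : ℝ) < M + 1 := by positivity
  rw [paramRadius, lt_div_iff₀ this] at h
  linarith

theorem abs_lt_one_of_abs_lt (h : |α| < paramRadius M) : |α| < 1 := by
  have : (0 : ℝ) < M + 1 := by positivity
  refine h.trans ?_
  rw [paramRadius, div_lt_one this]; linarith

theorem paramRadius_pos (hM : 2 ≤ M) : 0 < paramRadius M := by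
  have : (2 : ℝ) ≤ M := by exact_mod_cast hM
  exact div_pos (by linarith) (by linarith)

theorem isDiscRoot_discRoot (hM : 2 ≤ M) (hζ : ‖ζ‖ = 1) (hα : |α| < paramRadius M) :
    IsDiscRoot M ζ α (discRoot M ζ α) :=
  Classical.epsilon_spec (exists_isDiscRoot hM hζ (mul_abs_lt_of_abs_lt hα))

theorem IsDiscRoot.eq_discRoot {u : ℂ} (hu : IsDiscRoot M ζ α u) (hM : 2 ≤ M) (hζ : ‖ζ‖ = 1)
    (hα : |α| < 1) : u = discRoot M ζ α :=
  hu.unique hM hζ hα (Classical.epsilon_spec ⟨u, hu⟩)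

theorem discRoot_zero (hM : 2 ≤ M) (hζ : ‖ζ‖ = 1) : discRoot M ζ 0 = 0 := by
  refine (IsDiscRoot.eq_discRoot ⟨by simp, ?_⟩ hM hζ (by simp)).symm
  simp [show M ≠ 0 by omega]

/-- The equation is affine in `α`, so `α = A u` for an explicit rational function `A`. Simplicity of
the root gives `deriv A u ≠ 0`; the local inverse of `A` is analytic and agrees with `discRoot` by
uniqueness. -/
theorem analyticAt_discRoot (hM : 2 ≤ M) (hζ : ‖ζ‖ = 1) (hα : |α| < paramRadius M) :
    AnalyticAt ℝ (discRoot M ζ) α := by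
  have hα1 := abs_lt_one_of_abs_lt hα
  have hu := isDiscRoot_discRoot hM hζ hα
  set u := discRoot M ζ α with hudef
  set A : ℂ → ℂ := fun u => (u - ζ * u ^ M) / (1 - ζ * u ^ (M + 1)) with hA
  have hden : ∀ w : ℂ, ‖w‖ < 1 → 1 - ζ * w ^ (M + 1) ≠ 0 := by
    intro w hw h
    have h1 : ‖ζ * w ^ (M + 1)‖ = 1 := by rw [← sub_eq_zero.mp h, norm_one]
    rw [norm_mul, hζ, one_mul, norm_pow] at h1
    exact (pow_lt_one₀ (norm_nonneg w) hw (by omega)).ne h1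
  have hAu : A u = α := by
    rw [hA, div_eq_iff (hden u hu.1)]
    linear_combination hu.2
  have hAa : AnalyticAt ℂ A u := by
    have := hden u hu.1
    simp only [hA]
    fun_prop (disch := assumption)
  have hderiv : deriv A u ≠ 0 := by
    have h1 : HasDerivAt A (((1 - ζ * (M * u ^ (M - 1))) * (1 - ζ * u ^ (M + 1)) -
        (u - ζ * u ^ M) * (-(ζ * ((M + 1 : ℕ) * u ^ M)))) / (1 - ζ * u ^ (M + 1)) ^ 2) u :=
      ((hasDerivAt_id u).sub ((hasDerivAt_pow M u).const_mul ζ)).div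
        (((hasDerivAt_pow (M + 1) u).const_mul ζ).const_sub 1) (hden u hu.1)
    rw [h1.deriv]
    refine div_ne_zero (fun h => ?_) (pow_ne_zero _ (hden u hu.1))
    have h2 : u - ζ * u ^ M = α * (1 - ζ * u ^ (M + 1)) := by linear_combination hu.2
    rw [h2] at h
    have h3 : (1 - ζ * (M * u ^ (M - 1))) + α * (ζ * ((M + 1 : ℕ) * u ^ M)) = 0 := by
      apply mul_left_cancel₀ (hden u hu.1)
      linear_combination h
    apply hu.derivative_ne_zero hM hζ hα1
    have h4 : u ^ M = u ^ (M - 1) * u := by rw [← pow_succ]; congr 1; omega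
    have h5 := hu.2
    push_cast at h3
    rw [h4] at h3 h5
    -- Multiplying by `1 - α u` and eliminating with the root equation gives the expression of
    -- `derivative_ne_zero`.
    linear_combination (-(1 - α * u)) * h3 - α * h5
  set r := hAa.hasStrictDerivAt.localInverse _ _ _ hderiv with hr
  have hra : AnalyticAt ℂ r (A u) := hAa.analyticAt_localInverse hderiv
  have hru : r (A u) = u := HasStrictFDerivAt.localInverse_apply_image ..
  have hright : ∀ᶠ x in 𝓝 (A u), A (r x) = x :=
    HasStrictDerivAt.eventually_right_inverse ..
  rw [hAu] at hra hru hright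
  have hreal : AnalyticAt ℝ (fun t : ℝ => r t) α :=
    (hra.restrictScalars (𝕜 := ℝ)).comp (g := r) (f := fun t : ℝ => (t : ℂ))
      (Complex.ofRealCLM.analyticAt α)
  refine hreal.congr ?_
  have htend : Tendsto (fun t : ℝ => (t : ℂ)) (𝓝 α) (𝓝 (α : ℂ)) :=
    Complex.continuous_ofReal.tendsto α
  have hball : ∀ᶠ t : ℝ in 𝓝 α, ‖r t‖ < 1 := by
    have := hreal.continuousAt.norm
    exact this.eventually_lt continuousAt_const (by simpa [hru] using hu.1)
  have habs : ∀ᶠ t : ℝ in 𝓝 α, |t| < 1 :=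
    (continuous_abs.continuousAt).eventually_lt continuousAt_const hα1
  filter_upwards [htend.eventually hright, hball, habs] with t h1 h2 h3
  refine IsDiscRoot.eq_discRoot ⟨h2, ?_⟩ hM hζ h3
  rw [hA, div_eq_iff (hden _ h2)] at h1
  linear_combination h1

theorem tendsto_discRoot (hM : 2 ≤ M) (hζ : ‖ζ‖ = 1) :
    Tendsto (discRoot M ζ) (𝓝[≠] 0) (𝓝 0) := by
  have h := (analyticAt_discRoot (α := 0) hM hζ (by simpa using paramRadius_pos hM)).continuousAt
  have := h.tendsto
  rw [discRoot_zero hM hζ] at this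
  exact this.mono_left nhdsWithin_le_nhds

theorem tendsto_ofReal_nhdsNE : Tendsto (fun t : ℝ => (t : ℂ)) (𝓝[≠] 0) (𝓝 0) :=
  (Complex.continuous_ofReal.tendsto' 0 0 (by simp)).mono_left nhdsWithin_le_nhds

theorem eventually_abs_lt_paramRadius (hM : 2 ≤ M) :
    ∀ᶠ t : ℝ in 𝓝[≠] 0, |t| < paramRadius M :=
  nhdsWithin_le_nhds ((continuous_abs.continuousAt).eventually_lt continuousAt_const
    (by simpa using paramRadius_pos hM))

/-- The equation can be written `u * (1 - ζ u ^ (M - 1) + t ζ u ^ M) = t`, and the bracket tends to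
`1`. -/
theorem tendsto_discRoot_div (hM : 2 ≤ M) (hζ : ‖ζ‖ = 1) :
    Tendsto (fun t : ℝ => discRoot M ζ t / t) (𝓝[≠] 0) (𝓝 1) := by
  have hU := tendsto_discRoot hM hζ
  have hlim : Tendsto (fun t : ℝ => 1 - ζ * discRoot M ζ t ^ (M - 1) +
      t * (ζ * discRoot M ζ t ^ M)) (𝓝[≠] 0) (𝓝 1) := by
    have := (tendsto_const_nhds (x := (1 : ℂ))).sub ((hU.pow (M - 1)).const_mul ζ) |>.add
      (tendsto_ofReal_nhdsNE.mul ((hU.pow M).const_mul ζ))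
    simpa [show M - 1 ≠ 0 by omega] using this
  have hinv := hlim.inv₀ one_ne_zero
  rw [inv_one] at hinv
  refine hinv.congr' ?_
  filter_upwards [eventually_abs_lt_paramRadius hM, self_mem_nhdsWithin] with t ht ht0
  have hu := isDiscRoot_discRoot hM hζ ht
  have ht0' : (t : ℂ) ≠ 0 := by exact_mod_cast ht0
  have h1 : discRoot M ζ t * (1 - ζ * discRoot M ζ t ^ (M - 1) +
      t * (ζ * discRoot M ζ t ^ M)) = t := by
    have h4 : discRoot M ζ t ^ M = discRoot M ζ t ^ (M - 1) * discRoot M ζ t := by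
      rw [← pow_succ]; congr 1; omega
    have h5 := hu.2
    rw [h4] at h5 ⊢
    linear_combination h5
  have h2 : (1 - ζ * discRoot M ζ t ^ (M - 1) + t * (ζ * discRoot M ζ t ^ M)) ≠ 0 := by
    intro h; rw [h, mul_zero] at h1; exact ht0' h1.symm
  rw [eq_div_iff ht0', inv_mul_eq_iff_eq_mul₀ h2, mul_comm, h1]

theorem tendsto_discRoot_pow_div (hM : 2 ≤ M) (hζ : ‖ζ‖ = 1) :
    Tendsto (fun t : ℝ => discRoot M ζ t ^ M / t ^ M) (𝓝[≠] 0) (𝓝 1) := by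
  simpa [div_pow] using (tendsto_discRoot_div hM hζ).pow M

/-- The difference is `2 (u - t) / ((1 - u)(1 - t))`, with `u - t = ζ u ^ M (1 - t u)` and `u ~ t`.
This is the first order at which saddles of different `ζ` separate. -/
theorem tendsto_toHalfPlane_sub_div (hM : 2 ≤ M) (hζ : ‖ζ‖ = 1) :
    Tendsto (fun t : ℝ => (toHalfPlane (discRoot M ζ t) - toHalfPlane t) / t ^ M)
      (𝓝[≠] 0) (𝓝 (2 * ζ)) := by
  have hU := tendsto_discRoot hM hζ
  have ht := tendsto_ofReal_nhdsNE
  have h1 := tendsto_const_nhds (x := (1 : ℂ)) (f := 𝓝[≠] (0 : ℝ))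
  have hlim := (((tendsto_discRoot_pow_div hM hζ).const_mul (2 * ζ)).mul
    (h1.sub (ht.mul hU))).div ((h1.sub hU).mul (h1.sub ht)) (by simp)
  simp only [mul_one, mul_zero, sub_zero, div_one] at hlim
  refine hlim.congr' ?_
  filter_upwards [eventually_abs_lt_paramRadius hM, self_mem_nhdsWithin] with t ht' ht0
  have hu := isDiscRoot_discRoot hM hζ ht'
  have ht0' : (t : ℂ) ^ M ≠ 0 := pow_ne_zero _ (by exact_mod_cast ht0)
  have hd1 : 1 - discRoot M ζ t ≠ 0 := one_sub_ne_zero_of_norm_lt_one hu.1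
  have hd2 : 1 - (t : ℂ) ≠ 0 := 
    one_sub_ne_zero_of_norm_lt_one (by simpa using abs_lt_one_of_abs_lt ht')
  have h3 := hu.2
  have h4 : toHalfPlane (discRoot M ζ t) - toHalfPlane t =
      2 * ζ * discRoot M ζ t ^ M * (1 - t * discRoot M ζ t) /
        ((1 - discRoot M ζ t) * (1 - t)) := by
    rw [toHalfPlane, toHalfPlane, div_sub_div _ _ hd1 hd2]
    congr 1
    linear_combination 2 * h3
  rw [Pi.div_apply, h4]
  field_simp

end

/-- A function that is analytic on `(-A, A)` and has exact order `k` at `0` has finitely many zeros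
in `[0, B]` for `B < A`, provided that `0` is not counted. -/
theorem finite_zeros_of_tendsto_div_pow {F : ℝ → ℝ} {A B L : ℝ} (k : ℕ)
    (hF : ∀ t, |t| < A → AnalyticAt ℝ F t) (hA : 0 < A) (hBA : B < A)
    (hlim : Tendsto (fun t => F t / t ^ k) (𝓝[≠] 0) (𝓝 L)) (hL : L ≠ 0) :
    {t ∈ Set.Icc 0 B | F t = 0}.Finite := by
  by_contra hinf
  obtain ⟨x, hx, hacc⟩ := Set.Infinite.exists_accPt_of_subset_isCompact hinf
    (isCompact_Icc (a := (0 : ℝ)) (b := B)) (Set.sep_subset _ _)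
  rw [accPt_iff_frequently_nhdsNE] at hacc
  have hU : AnalyticOnNhd ℝ F (Set.Ioo (-A) A) := fun t ht => hF t (abs_lt.mpr ht)
  -- The symmetric interval keeps an accumulation point at `0` interior, so the identity theorem
  -- covers that case too.
  have hzero := hU.eqOn_zero_of_preconnected_of_frequently_eq_zero isPreconnected_Ioo
    (show x ∈ Set.Ioo (-A) A from ⟨by linarith [hx.1], by linarith [hx.2]⟩)
    (hacc.mono fun t ht => ht.2)
  have h0 : Tendsto (fun t => F t / t ^ k) (𝓝[≠] 0) (𝓝 0) := by
    refine tendsto_const_nhds.congr' ?_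
    filter_upwards [nhdsWithin_le_nhds (Ioo_mem_nhds (neg_lt_zero.mpr hA) hA)] with t ht
    rw [hzero ht]; simp
  exact hL (tendsto_nhds_unique hlim h0)

/-! ### Möbius coordinates -/

/-- The Möbius map sending the right half plane to the unit disc. -/
noncomputable def toDisc (z : ℂ) : ℂ := (z - 1) / (z + 1)

theorem add_one_ne_zero_of_re_pos {z : ℂ} (hz : 0 < z.re) : z + 1 ≠ 0 := by
  intro h
  have := congrArg Complex.re h
  simp at this; linarith

theorem norm_toDisc_lt_one {z : ℂ} (hz : 0 < z.re) : ‖toDisc z‖ < 1 := by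
  rw [toDisc, norm_div, div_lt_one (norm_pos_iff.mpr (add_one_ne_zero_of_re_pos hz))]
  rw [← sq_lt_sq₀ (norm_nonneg _) (norm_nonneg _), ← Complex.normSq_eq_norm_sq,
    ← Complex.normSq_eq_norm_sq, Complex.normSq_apply, Complex.normSq_apply]
  simp; nlinarith

theorem toHalfPlane_toDisc {z : ℂ} (hz : 0 < z.re) : toHalfPlane (toDisc z) = z := by
  have h := add_one_ne_zero_of_re_pos hz
  have h2 : 1 - toDisc z ≠ 0 := one_sub_ne_zero_of_norm_lt_one (norm_toDisc_lt_one hz)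
  rw [toHalfPlane, div_eq_iff h2, toDisc]
  field_simp
  ring

theorem re_toHalfPlane {u : ℂ} : (toHalfPlane u).re = (1 - ‖u‖ ^ 2) / ‖1 - u‖ ^ 2 := by
  rw [toHalfPlane, Complex.div_re, ← Complex.normSq_eq_norm_sq, ← Complex.normSq_eq_norm_sq,
    ← add_div, Complex.normSq_apply u]
  congr 1
  simp; ring

theorem re_toHalfPlane_pos {u : ℂ} (hu : ‖u‖ < 1) : 0 < (toHalfPlane u).re := by
  rw [re_toHalfPlane]
  have h := norm_pos_iff.mpr (one_sub_ne_zero_of_norm_lt_one hu)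
  have : 0 < 1 - ‖u‖ ^ 2 := by nlinarith [norm_nonneg u]
  positivity

theorem toDisc_toHalfPlane {u : ℂ} (hu : ‖u‖ < 1) : toDisc (toHalfPlane u) = u := by
  have h := one_sub_ne_zero_of_norm_lt_one hu
  have h2 := add_one_ne_zero_of_re_pos (re_toHalfPlane_pos hu)
  rw [toDisc, div_eq_iff h2, toHalfPlane]
  field_simp
  ring

theorem toHalfPlane_conj (u : ℂ) :
    toHalfPlane ((starRingEnd ℂ) u) = (starRingEnd ℂ) (toHalfPlane u) := by
  simp [toHalfPlane]

theorem toHalfPlane_sub_center {u : ℂ} {r : ℝ} (hu : ‖u‖ < 1) (hr : 0 < r) :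
    (toHalfPlane u - (2 * r + 1)) * (1 - u) =
      2 * (r + 1) * (u - ((r / (r + 1) : ℝ) : ℂ)) := by
  have h := one_sub_ne_zero_of_norm_lt_one hu
  have h2 : (r : ℂ) + 1 ≠ 0 := by exact_mod_cast (by linarith : r + 1 ≠ 0)
  rw [toHalfPlane]; push_cast
  field_simp
  ring

theorem toHalfPlane_add_center {u : ℂ} {r : ℝ} (hu : ‖u‖ < 1) (hr : 0 < r) :
    (toHalfPlane u + (2 * r + 1)) * (1 - u) =
      2 * (r + 1) * (1 - ((r / (r + 1) : ℝ) : ℂ) * u) := by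
  have h := one_sub_ne_zero_of_norm_lt_one hu
  have h2 : (r : ℂ) + 1 ≠ 0 := by exact_mod_cast (by linarith : r + 1 ≠ 0)
  rw [toHalfPlane]; push_cast
  field_simp
  ring

theorem toHalfPlane_sub_one {u : ℂ} (hu : ‖u‖ < 1) : (toHalfPlane u - 1) * (1 - u) = 2 * u := by
  have h := one_sub_ne_zero_of_norm_lt_one hu
  rw [toHalfPlane]
  field_simp
  ring

theorem toHalfPlane_add_one {u : ℂ} (hu : ‖u‖ < 1) : (toHalfPlane u + 1) * (1 - u) = 2 := by
  have h := one_sub_ne_zero_of_norm_lt_one hu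
  rw [toHalfPlane]
  field_simp
  ring

theorem div_add_one_mem {r : ℝ} (hr : 0 < r) : 0 < r / (r + 1) ∧ r / (r + 1) < 1 :=
  ⟨by positivity, by rw [div_lt_one (by linarith)]; linarith⟩

theorem abs_div_add_one_lt_one {r : ℝ} (hr : 0 < r) : |r / (r + 1)| < 1 := by
  rw [abs_of_pos (div_add_one_mem hr).1]; exact (div_add_one_mem hr).2

/-! ### Saddle points indexed by roots of unity -/

section

variable {a b M : ℕ} {r : ℝ} {ζ u z : ℂ}

/-- After multiplication by `(1 - u) ^ (b + M * b)`, the four linear factors of `Q` become constants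
times `1 - α u`, `u`, `u - α` and `1`. -/
theorem isRoot_Q_toHalfPlane_iff (hab : a + b = M * b) (hr : 0 < r) (hu : ‖u‖ < 1) :
    (Q a b r).IsRoot (toHalfPlane u) ↔
      (u - ((r / (r + 1) : ℝ) : ℂ)) ^ b = (u ^ M * (1 - ((r / (r + 1) : ℝ) : ℂ) * u)) ^ b := by
  have h := one_sub_ne_zero_of_norm_lt_one hu
  have h2 : (r : ℂ) + 1 ≠ 0 := by exact_mod_cast (by linarith : r + 1 ≠ 0)
  have e1 := congrArg (· ^ b) (toHalfPlane_sub_center hu hr)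
  have e2 := congrArg (· ^ b) (toHalfPlane_add_center hu hr)
  have e3 := congrArg (· ^ (M * b)) (toHalfPlane_sub_one hu)
  have e4 := congrArg (· ^ (M * b)) (toHalfPlane_add_one hu)
  simp only [mul_pow] at e1 e2 e3 e4
  set α : ℂ := ((r / (r + 1) : ℝ) : ℂ)
  have key : (Q a b r).eval (toHalfPlane u) * (1 - u) ^ (b + M * b) =
      (2 * (r + 1)) ^ b * 2 ^ (M * b) * ((u ^ M * (1 - α * u)) ^ b - (u - α) ^ b) := by
    have e5 : (Q a b r).eval (toHalfPlane u) =
        (toHalfPlane u + (2 * r + 1)) ^ b * (toHalfPlane u - 1) ^ (M * b)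
          - (toHalfPlane u - (2 * r + 1)) ^ b * (toHalfPlane u + 1) ^ (M * b) := by
      simp [Q, hab]
    rw [e5, pow_add, mul_pow (u ^ M), ← pow_mul u]
    calc _ = ((toHalfPlane u + (2 * r + 1)) ^ b * (1 - u) ^ b) *
          ((toHalfPlane u - 1) ^ (M * b) * (1 - u) ^ (M * b)) -
          ((toHalfPlane u - (2 * r + 1)) ^ b * (1 - u) ^ b) *
          ((toHalfPlane u + 1) ^ (M * b) * (1 - u) ^ (M * b)) := by ring
      _ = _ := by rw [e1, e2, e3, e4, mul_pow 2 ((r : ℂ) + 1)]; ring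
  rw [IsRoot.def]
  constructor
  · intro h0
    rw [h0, zero_mul, eq_comm] at key
    have h3 : ((2 * ((r : ℂ) + 1)) ^ b * 2 ^ (M * b)) ≠ 0 :=
      mul_ne_zero (pow_ne_zero _ (mul_ne_zero two_ne_zero h2)) (pow_ne_zero _ two_ne_zero)
    exact (sub_eq_zero.mp ((mul_eq_zero.mp key).resolve_left h3)).symm
  · intro h0
    rw [h0, sub_self, mul_zero] at key
    exact (mul_eq_zero.mp key).resolve_right (pow_ne_zero _ h)

theorem isRoot_Q_toHalfPlane_iff_exists (hab : a + b = M * b) (hb : b ≠ 0) (hM : M ≠ 0)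
    (hr : 0 < r) (hu : ‖u‖ < 1) :
    (Q a b r).IsRoot (toHalfPlane u) ↔ ∃ ζ : ℂ, ζ ^ b = 1 ∧ IsDiscRoot M ζ (r / (r + 1)) u := by
  rw [isRoot_Q_toHalfPlane_iff hab hr hu]
  have hα := div_add_one_mem hr
  have h1 : 1 - ((r / (r + 1) : ℝ) : ℂ) * u ≠ 0 :=
    one_sub_mul_ne_zero (by rw [Complex.norm_real]; exact abs_div_add_one_lt_one hr) hu
  constructor
  · intro h
    have hu0 : u ≠ 0 := by
      rintro rfl
      rw [zero_pow hM, zero_mul, zero_pow hb, zero_sub] at h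
      have := pow_eq_zero_iff hb |>.mp h
      rw [neg_eq_zero] at this
      exact hα.1.ne' (by exact_mod_cast this)
    have h2 : u ^ M * (1 - ((r / (r + 1) : ℝ) : ℂ) * u) ≠ 0 := mul_ne_zero (pow_ne_zero _ hu0) h1
    refine ⟨(u - ((r / (r + 1) : ℝ) : ℂ)) / (u ^ M * (1 - ((r / (r + 1) : ℝ) : ℂ) * u)), ?_, hu, ?_⟩
    · rw [div_pow, h, div_self (pow_ne_zero _ h2)]
    · rw [mul_assoc, div_mul_cancel₀ _ h2]
  · rintro ⟨ζ, hζ, hroot⟩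
    rw [hroot.2, mul_assoc, mul_pow, hζ, one_mul]

/-- The root of `Q` in the right half plane that belongs to the root of unity `ζ`. -/
noncomputable def saddle (M : ℕ) (r : ℝ) (ζ : ℂ) : ℂ :=
  toHalfPlane (discRoot M ζ (r / (r + 1)))

theorem norm_eq_one_of_pow_eq_one (hb : b ≠ 0) (hζ : ζ ^ b = 1) : ‖ζ‖ = 1 :=
  Complex.norm_eq_one_of_pow_eq_one hζ hb

theorem re_saddle_pos (hM : 2 ≤ M) (hr1 : |r / (r + 1)| < paramRadius M)
    (hζ : ‖ζ‖ = 1) : 0 < (saddle M r ζ).re :=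
  re_toHalfPlane_pos (isDiscRoot_discRoot hM hζ hr1).1

theorem isRoot_Q_iff_exists_saddle (hab : a + b = M * b) (hb : b ≠ 0) (hM : 2 ≤ M) (hr : 0 < r)
    (hr1 : |r / (r + 1)| < paramRadius M) (hz : 0 < z.re) :
    (Q a b r).IsRoot z ↔ ∃ ζ : ℂ, ζ ^ b = 1 ∧ z = saddle M r ζ := by
  rw [← toHalfPlane_toDisc hz, isRoot_Q_toHalfPlane_iff_exists hab hb (by omega) hr
    (norm_toDisc_lt_one hz)]
  refine exists_congr fun ζ => and_congr_right fun hζ => ?_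
  have hn := norm_eq_one_of_pow_eq_one hb hζ
  constructor
  · intro h
    rw [saddle, ← h.eq_discRoot hM hn (abs_div_add_one_lt_one hr)]
  · intro h
    have h2 := congrArg toDisc h
    rw [toDisc_toHalfPlane (norm_toDisc_lt_one hz), saddle,
      toDisc_toHalfPlane (isDiscRoot_discRoot hM hn hr1).1] at h2
    rw [h2]
    exact isDiscRoot_discRoot hM hn hr1

theorem saddle_injOn (hM : 2 ≤ M) (hr : 0 < r) (hr1 : |r / (r + 1)| < paramRadius M)
    {ζ ζ' : ℂ} (hζ : ‖ζ‖ = 1) (hζ' : ‖ζ'‖ = 1) (h : saddle M r ζ = saddle M r ζ') : ζ = ζ' := by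
  have h1 := isDiscRoot_discRoot hM hζ hr1
  have h2 := isDiscRoot_discRoot hM hζ' hr1
  have h3 := congrArg toDisc h
  rw [saddle, saddle, toDisc_toHalfPlane h1.1, toDisc_toHalfPlane h2.1] at h3
  rw [← h3] at h2
  have h4 := h1.ne_zero_of_ne (div_add_one_mem hr).1.ne' (by omega)
  have h5 := h1.one_sub_ne_zero (abs_div_add_one_lt_one hr)
  have h6 := h1.2.symm.trans h2.2
  exact mul_right_cancel₀ (pow_ne_zero M h4) (mul_right_cancel₀ h5 h6)

theorem IsDiscRoot.conj {α : ℝ} (hu : IsDiscRoot M ζ α u) :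
    IsDiscRoot M ((starRingEnd ℂ) ζ) α ((starRingEnd ℂ) u) :=
  ⟨by simpa using hu.1, by simpa using congrArg (starRingEnd ℂ) hu.2⟩

theorem saddle_conj (hM : 2 ≤ M) (hr1 : |r / (r + 1)| < paramRadius M) (hζ : ‖ζ‖ = 1) :
    saddle M r ((starRingEnd ℂ) ζ) = (starRingEnd ℂ) (saddle M r ζ) := by
  rw [saddle, saddle, ← toHalfPlane_conj]
  congr 1
  exact ((isDiscRoot_discRoot hM hζ hr1).conj.eq_discRoot hM (by simpa using hζ)
    (abs_lt_one_of_abs_lt hr1)).symm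

theorem conj_ne_self (hb : Odd b) (hζ : ζ ^ b = 1) (h1 : ζ ≠ 1) : ζ.im ≠ 0 := by
  intro him
  have hz : ζ = (ζ.re : ℂ) := Complex.ext (by simp) (by simpa using him)
  rw [hz] at hζ h1
  have h2 : ζ.re ^ b = 1 := by exact_mod_cast hζ
  have h3 : ζ.re = 1 := hb.strictMono_pow.injective (by simpa using h2)
  exact h1 (by rw [h3]; simp)

/-- A real saddle would belong to both `ζ` and its conjugate, against injectivity. -/
theorem im_saddle_ne_zero (hM : 2 ≤ M) (hr : 0 < r) (hr1 : |r / (r + 1)| < paramRadius M)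
    (hζ : ‖ζ‖ = 1) (him : ζ.im ≠ 0) : (saddle M r ζ).im ≠ 0 := by
  intro h
  have h1 := saddle_conj hM hr1 hζ
  rw [Complex.conj_eq_iff_im.mpr h] at h1
  exact him (Complex.conj_eq_iff_im.mp (saddle_injOn hM hr hr1 (by simpa using hζ) hζ h1))

/-- For `ζ = 1` the root in the disc is real and lies in `(α, 1)`. -/
theorem exists_real_discRoot (hM : 2 ≤ M) (hMe : Even M) (hr : 0 < r)
    (hr1 : |r / (r + 1)| < paramRadius M) :
    ∃ x : ℝ, r / (r + 1) < x ∧ x < 1 ∧ discRoot M 1 (r / (r + 1)) = x := by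
  have h := isDiscRoot_discRoot hM norm_one hr1
  have h1 : (starRingEnd ℂ) (discRoot M 1 (r / (r + 1))) = discRoot M 1 (r / (r + 1)) := by
    refine IsDiscRoot.eq_discRoot ?_ hM norm_one (abs_lt_one_of_abs_lt hr1)
    simpa using h.conj
  obtain ⟨x, hx⟩ := Complex.conj_eq_iff_real.mp h1
  rw [hx] at h
  have hx0 : x ≠ 0 := by
    have := h.ne_zero_of_ne (div_add_one_mem hr).1.ne' (by omega)
    exact_mod_cast this
  have hlt : |x| < 1 := by simpa using h.1
  have heq : x - r / (r + 1) = x ^ M * (1 - r / (r + 1) * x) := by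
    have := h.2
    rw [one_mul] at this
    exact_mod_cast this
  refine ⟨x, ?_, (abs_lt.mp hlt).2, hx⟩
  -- Evenness of `M` gives positivity before the sign of `x` is known; hence `x - α > 0`.
  have h2 : 0 < x ^ M := hMe.pow_pos hx0
  have h3 : 0 < 1 - r / (r + 1) * x := by
    have := div_add_one_mem hr
    have h4 := abs_lt.mp hlt
    nlinarith
  have := mul_pos h2 h3
  linarith

theorem exists_real_saddle (hM : 2 ≤ M) (hMe : Even M) (hr : 0 < r)
    (hr1 : |r / (r + 1)| < paramRadius M) :
    ∃ μ : ℝ, 2 * r + 1 < μ ∧ saddle M r 1 = μ := by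
  obtain ⟨x, hx, hx1, hroot⟩ := exists_real_discRoot hM hMe hr hr1
  refine ⟨(1 + x) / (1 - x), ?_, by rw [saddle, hroot, toHalfPlane]; push_cast; rfl⟩
  rw [lt_div_iff₀ (by linarith)]
  rw [div_lt_iff₀ (by linarith)] at hx
  nlinarith

open Classical in
/-- The `b`-th roots of unity whose saddle point lies in the upper half plane. -/
noncomputable def upperUnits (M b : ℕ) (r : ℝ) : Finset ℂ :=
  (nthRootsFinset b (1 : ℂ)).filter fun ζ => 0 < (saddle M r ζ).im

theorem mem_upperUnits (hb : 0 < b) :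
    ζ ∈ upperUnits M b r ↔ ζ ^ b = 1 ∧ 0 < (saddle M r ζ).im := by
  rw [upperUnits, Finset.mem_filter, mem_nthRootsFinset hb]

/-- Conjugation matches the roots of unity with saddle above the real axis to those with saddle
below it, and only `ζ = 1` has a real saddle. -/
theorem card_upperUnits (hM : 2 ≤ M) (hMe : Even M) (hb : Odd b) (hr : 0 < r)
    (hr1 : |r / (r + 1)| < paramRadius M) : 2 * (upperUnits M b r).card + 1 = b := by
  classical
  have hb0 : 0 < b := hb.pos
  set Z := nthRootsFinset b (1 : ℂ) with hZ
  have hcard : Z.card = b := (Complex.isPrimitiveRoot_exp b hb0.ne').card_nthRootsFinset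
  have hnorm : ∀ ζ ∈ Z, ‖ζ‖ = 1 := fun ζ h =>
    norm_eq_one_of_pow_eq_one hb0.ne' ((mem_nthRootsFinset hb0 _).mp h)
  set L := Z.filter fun ζ => (saddle M r ζ).im < 0 with hL
  have hconj : ∀ ζ ∈ Z, (starRingEnd ℂ) ζ ∈ Z := by
    intro ζ h
    rw [hZ, mem_nthRootsFinset hb0] at h ⊢
    rw [← map_pow, h, map_one]
  have hLU : (upperUnits M b r).card = L.card := by
    refine Finset.card_bij (fun ζ _ => (starRingEnd ℂ) ζ) ?_ ?_ ?_
    · intro ζ h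
      obtain ⟨h1, h2⟩ := Finset.mem_filter.mp h
      refine Finset.mem_filter.mpr ⟨hconj ζ h1, ?_⟩
      rw [saddle_conj hM hr1 (hnorm ζ h1), Complex.conj_im]
      linarith
    · intro ζ _ ζ' _ h
      exact (starRingEnd ℂ).injective h
    · intro ζ h
      obtain ⟨h1, h2⟩ := Finset.mem_filter.mp h
      refine ⟨(starRingEnd ℂ) ζ, Finset.mem_filter.mpr ⟨hconj ζ h1, ?_⟩, by simp⟩
      rw [saddle_conj hM hr1 (hnorm ζ h1), Complex.conj_im]
      linarith
  have hsplit : Z = insert 1 (upperUnits M b r ∪ L) := by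
    ext ζ
    simp only [Finset.mem_insert, Finset.mem_union, hL, upperUnits, Finset.mem_filter, ← hZ]
    constructor
    · intro h
      by_cases h1 : ζ = 1
      · exact Or.inl h1
      have h2 := im_saddle_ne_zero hM hr hr1 (hnorm ζ h)
        (conj_ne_self hb ((mem_nthRootsFinset hb0 _).mp h) h1)
      rcases lt_or_gt_of_ne h2 with h3 | h3
      · exact Or.inr (Or.inr ⟨h, h3⟩)
      · exact Or.inr (Or.inl ⟨h, h3⟩)
    · rintro (rfl | h | h)
      · rw [hZ, mem_nthRootsFinset hb0, one_pow]
      · exact h.1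
      · exact h.1
  obtain ⟨μ, -, hμ⟩ := exists_real_saddle hM hMe hr hr1
  have h1 : (1 : ℂ) ∉ upperUnits M b r ∪ L := by
    simp [hL, upperUnits, hμ]
  have hdisj : Disjoint (upperUnits M b r) L := by
    rw [Finset.disjoint_left]
    intro ζ h h'
    have h2 := (Finset.mem_filter.mp h).2
    have h3 := (Finset.mem_filter.mp h').2
    exact absurd h2 (not_lt.mpr h3.le)
  rw [hsplit, Finset.card_insert_of_notMem h1, Finset.card_union_of_disjoint hdisj, ← hLU] at hcard
  omega

/-- Saddle points in the upper half plane belonging to different roots of unity belong to roots of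
unity with different real parts. -/
theorem re_ne_of_mem_upperUnits (hM : 2 ≤ M) (hb : 0 < b) (hr1 : |r / (r + 1)| < paramRadius M)
    {ζ ζ' : ℂ} (hζ : ζ ∈ upperUnits M b r) (hζ' : ζ' ∈ upperUnits M b r) (hne : ζ ≠ ζ') :
    ζ.re ≠ ζ'.re := by
  intro hre
  rw [mem_upperUnits hb] at hζ hζ'
  have h1 := norm_eq_one_of_pow_eq_one hb.ne' hζ.1
  have h2 := norm_eq_one_of_pow_eq_one hb.ne' hζ'.1
  have h3 : ζ.im ^ 2 = ζ'.im ^ 2 := by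
    have e1 := Complex.sq_norm ζ
    have e2 := Complex.sq_norm ζ'
    rw [h1, Complex.normSq_apply] at e1
    rw [h2, Complex.normSq_apply, ← hre] at e2
    nlinarith
  rcases sq_eq_sq_iff_eq_or_eq_neg.mp h3 with h | h
  · exact hne (Complex.ext hre h)
  · have h4 : ζ = (starRingEnd ℂ) ζ' := Complex.ext (by simpa using hre) (by simpa using h)
    have h5 := hζ.2
    rw [h4, saddle_conj hM hr1 h2, Complex.conj_im] at h5
    linarith [hζ'.2]

end

/-! ### The amplitude and second derivative at saddle points -/

section

variable (a b : ℕ) (r : ℝ)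

/-- The second derivative of `f` as a rational function. -/
noncomputable def fSecond (z : ℂ) : ℂ :=
  b / (z + 2 * r + 1) + b / (2 * r + 1 - z) + (a + b) / (z - 1) - (a + b) / (z + 1)

/-- The square of `g` as a rational function. -/
noncomputable def gSquare (z : ℂ) : ℂ :=
  ((z + 2 * r + 1) ^ b * (2 * r + 1 - z) ^ b) / ((z + 1) ^ (a + b) * (z - 1) ^ (a + b))

variable {a b r}

/-- Squaring removes the half-integer powers, and with them every choice of branch. -/
theorem g_sq (z : ℂ) : g a b r z ^ 2 = gSquare a b r z := by
  have h1 : ∀ x : ℂ, (x ^ ((b : ℂ) / 2)) ^ 2 = x ^ b := by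
    intro x
    rw [← Complex.cpow_mul_nat]
    push_cast
    rw [div_mul_cancel₀ _ two_ne_zero, Complex.cpow_natCast]
  have h2 : ∀ x : ℂ, (x ^ (((a : ℂ) + b) / 2)) ^ 2 = x ^ (a + b) := by
    intro x
    rw [← Complex.cpow_mul_nat]
    push_cast
    rw [div_mul_cancel₀ _ two_ne_zero, ← Nat.cast_add, Complex.cpow_natCast]
  rw [g, gSquare, div_pow, mul_pow, mul_pow, h1, h1, h2, h2]

theorem hasDerivAt_mul_log {w : ℂ} (hw : w ∈ Complex.slitPlane) :
    HasDerivAt (fun t => t * Complex.log t) (Complex.log w + 1) w := by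
  refine ((hasDerivAt_id w).mul (Complex.hasDerivAt_log hw)).congr_deriv ?_
  simp [mul_inv_cancel₀ (Complex.slitPlane_ne_zero hw)]

theorem mem_slitPlane_of_im_ne_zero {z : ℂ} (h : z.im ≠ 0) : z ∈ Complex.slitPlane := Or.inr h

theorem hasDerivAt_f {z : ℂ} (hz : 0 < z.im) : HasDerivAt (f a b r)
    (b * Complex.log (z + 2 * r + 1) - b * Complex.log (2 * r + 1 - z)
      + (a + b) * Complex.log (z - 1) - (a + b) * Complex.log (z + 1)) z := by
  have h1 : HasDerivAt (fun t : ℂ => t + 2 * r + 1) 1 z :=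
    ((hasDerivAt_id z).add_const _).add_const _
  have h2 : HasDerivAt (fun t : ℂ => 2 * r + 1 - t) (-1) z := (hasDerivAt_id z).const_sub _
  have h3 : HasDerivAt (fun t : ℂ => t - 1) 1 z := (hasDerivAt_id z).sub_const _
  have h4 : HasDerivAt (fun t : ℂ => t + 1) 1 z := (hasDerivAt_id z).add_const _
  have k1 := (hasDerivAt_mul_log (w := z + 2 * r + 1)
    (mem_slitPlane_of_im_ne_zero (by simpa using hz.ne'))).comp z h1
  have k2 := (hasDerivAt_mul_log (w := 2 * r + 1 - z)
    (mem_slitPlane_of_im_ne_zero (by simpa using hz.ne'))).comp z h2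
  have k3 := (hasDerivAt_mul_log (w := z - 1)
    (mem_slitPlane_of_im_ne_zero (by simpa using hz.ne'))).comp z h3
  have k4 := (hasDerivAt_mul_log (w := z + 1)
    (mem_slitPlane_of_im_ne_zero (by simpa using hz.ne'))).comp z h4
  have k := ((((k1.const_mul (b : ℂ)).add (k2.const_mul (b : ℂ))).add
    (k3.const_mul ((a : ℂ) + b))).sub (k4.const_mul ((a : ℂ) + b))).add_const
      (2 * (a - 2 * b * r) * Complex.log 2)
  refine (k.congr_deriv ?_).congr_of_eventuallyEq (Eventually.of_forall fun t => ?_)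
  · ring
  · simp only [f, Function.comp, Pi.add_apply, Pi.sub_apply]; ring

theorem deriv_deriv_f {z : ℂ} (hz : 0 < z.im) : deriv (deriv (f a b r)) z = fSecond a b r z := by
  have hev : deriv (f a b r) =ᶠ[𝓝 z] fun z =>
      b * Complex.log (z + 2 * r + 1) - b * Complex.log (2 * r + 1 - z)
      + (a + b) * Complex.log (z - 1) - (a + b) * Complex.log (z + 1) := by
    filter_upwards [(isOpen_lt continuous_const Complex.continuous_im).mem_nhds hz] with w hw
    exact (hasDerivAt_f hw).deriv
  rw [hev.deriv_eq]
  have h1 : HasDerivAt (fun t : ℂ => t + 2 * r + 1) 1 z :=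
    ((hasDerivAt_id z).add_const _).add_const _
  have h2 : HasDerivAt (fun t : ℂ => 2 * r + 1 - t) (-1) z := (hasDerivAt_id z).const_sub _
  have h3 : HasDerivAt (fun t : ℂ => t - 1) 1 z := (hasDerivAt_id z).sub_const _
  have h4 : HasDerivAt (fun t : ℂ => t + 1) 1 z := (hasDerivAt_id z).add_const _
  have k := ((((h1.clog (mem_slitPlane_of_im_ne_zero (by simpa using hz.ne'))).const_mul
    (b : ℂ)).sub ((h2.clog (mem_slitPlane_of_im_ne_zero (by simpa using hz.ne'))).const_mul
    (b : ℂ))).add ((h3.clog (mem_slitPlane_of_im_ne_zero (by simpa using hz.ne'))).const_mul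
    ((a : ℂ) + b))).sub ((h4.clog (mem_slitPlane_of_im_ne_zero (by simpa using hz.ne'))).const_mul
    ((a : ℂ) + b))
  have k' := k.deriv
  refine Eq.trans ?_ (k'.trans ?_)
  · rfl
  · rw [fSecond]; ring

/-- The upper half plane approach `z + iε`, with `ε ↓ 0`. -/
theorem tendsto_add_mul_I (z : ℂ) :
    Tendsto (fun ε : ℝ => z + ε * Complex.I) (𝓝[>] 0) (𝓝 z) := by
  have : Continuous (fun ε : ℝ => z + ε * Complex.I) := by fun_prop
  exact (this.tendsto' 0 z (by simp)).mono_left nhdsWithin_le_nhds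

theorem upperValue_deriv_deriv_f {z : ℂ} (hz : 0 ≤ z.im) (h1 : z + 2 * r + 1 ≠ 0)
    (h2 : 2 * r + 1 - z ≠ 0) (h3 : z - 1 ≠ 0) (h4 : z + 1 ≠ 0) :
    upperValue (deriv (deriv (f a b r))) z = fSecond a b r z := by
  apply Tendsto.limUnder_eq
  have hc : ContinuousAt (fSecond a b r) z := by
    unfold fSecond
    fun_prop (disch := assumption)
  refine (hc.tendsto.comp (tendsto_add_mul_I z)).congr' ?_
  filter_upwards [self_mem_nhdsWithin] with ε hε
  refine (deriv_deriv_f ?_).symm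
  have : (0 : ℝ) < ε := hε
  simp; linarith

theorem upperValue_g_sq_of_tendsto {z L : ℂ} (h3 : z - 1 ≠ 0) (h4 : z + 1 ≠ 0)
    (h : Tendsto (fun ε : ℝ => g a b r (z + ε * Complex.I)) (𝓝[>] 0) (𝓝 L)) :
    upperValue (g a b r) z ^ 2 = gSquare a b r z := by
  rw [upperValue, h.limUnder_eq]
  have hc : ContinuousAt (gSquare a b r) z := by
    have := mul_ne_zero (pow_ne_zero (a + b) h4) (pow_ne_zero (a + b) h3)
    unfold gSquare
    fun_prop (disch := assumption)
  refine tendsto_nhds_unique (h.pow 2) ?_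
  simp only [g_sq]
  exact hc.tendsto.comp (tendsto_add_mul_I z)

theorem upperValue_g_sq_of_im_pos {z : ℂ} (hz : 0 < z.im) :
    upperValue (g a b r) z ^ 2 = gSquare a b r z := by
  rw [upperValue_eq, g_sq]
  have hne : ∀ w : ℂ, w.im ≠ 0 → w ≠ 0 := by rintro w hw rfl; simp at hw
  have s1 : z + 2 * r + 1 ∈ Complex.slitPlane := Or.inr (by simpa using hz.ne')
  have s2 : 2 * r + 1 - z ∈ Complex.slitPlane := Or.inr (by simpa using hz.ne')
  have s3 : z - 1 ∈ Complex.slitPlane := Or.inr (by simpa using hz.ne')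
  have s4 : z + 1 ∈ Complex.slitPlane := Or.inr (by simpa using hz.ne')
  have hd : (z + 1) ^ (((a : ℂ) + b) / 2) * (z - 1) ^ (((a : ℂ) + b) / 2) ≠ 0 := by
    simp [Complex.cpow_eq_zero_iff, Complex.slitPlane_ne_zero s3, Complex.slitPlane_ne_zero s4]
  unfold g
  refine ContinuousAt.div (ContinuousAt.mul ?_ ?_) (ContinuousAt.mul ?_ ?_) hd
  · exact ContinuousAt.cpow (by fun_prop) continuousAt_const s1
  · exact ContinuousAt.cpow (by fun_prop) continuousAt_const s2
  · exact ContinuousAt.cpow (by fun_prop) continuousAt_const s4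
  · exact ContinuousAt.cpow (by fun_prop) continuousAt_const s3

/-- Only the factor `2r + 1 - τ` meets its cut. When `τ` descends to `μ` from above, this factor
approaches the negative axis from below, where the logarithm has a one-sided limit; so the limit of
`g` exists. -/
theorem upperValue_g_sq_of_real {μ : ℝ} (hr : 0 < r) (hμ : 2 * r + 1 < μ) :
    upperValue (g a b r) μ ^ 2 = gSquare a b r μ := by
  have hpos : ∀ x : ℝ, 0 < x → (x : ℂ) ∈ Complex.slitPlane := fun x hx => Or.inl (by simpa using hx)
  have e1 : (μ : ℂ) + 2 * r + 1 = ((μ + 2 * r + 1 : ℝ) : ℂ) := by push_cast; ring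
  have e2 : 2 * (r : ℂ) + 1 - μ = ((2 * r + 1 - μ : ℝ) : ℂ) := by push_cast; ring
  have e3 : (μ : ℂ) - 1 = ((μ - 1 : ℝ) : ℂ) := by push_cast; ring
  have e4 : (μ : ℂ) + 1 = ((μ + 1 : ℝ) : ℂ) := by push_cast; ring
  have s1 : (μ : ℂ) + 2 * r + 1 ∈ Complex.slitPlane := e1 ▸ hpos _ (by linarith)
  have s3 : (μ : ℂ) - 1 ∈ Complex.slitPlane := e3 ▸ hpos _ (by linarith)
  have s4 : (μ : ℂ) + 1 ∈ Complex.slitPlane := e4 ▸ hpos _ (by linarith)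
  have n2 : 2 * (r : ℂ) + 1 - μ ≠ 0 := by
    rw [e2]; exact_mod_cast (by linarith : 2 * r + 1 - μ ≠ 0)
  have hd : ((μ : ℂ) + 1) ^ (((a : ℂ) + b) / 2) * ((μ : ℂ) - 1) ^ (((a : ℂ) + b) / 2) ≠ 0 := by
    simp [Complex.cpow_eq_zero_iff, Complex.slitPlane_ne_zero s3, Complex.slitPlane_ne_zero s4]
  have hT := tendsto_add_mul_I (μ : ℂ)
  have t2 : Tendsto (fun ε : ℝ => 2 * (r : ℂ) + 1 - (μ + ε * Complex.I)) (𝓝[>] 0)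
      (𝓝[{z : ℂ | z.im < 0}] (2 * r + 1 - μ)) := by
    refine tendsto_nhdsWithin_iff.mpr ⟨tendsto_const_nhds.sub hT, ?_⟩
    filter_upwards [self_mem_nhdsWithin] with ε hε
    have : (0 : ℝ) < ε := hε
    simpa using this
  have tl := (Complex.tendsto_log_nhdsWithin_im_neg_of_re_neg_of_im_zero
    (z := 2 * (r : ℂ) + 1 - μ) (by rw [e2, Complex.ofReal_re]; linarith)
    (by rw [e2, Complex.ofReal_im])).comp t2
  have tc := (Complex.continuous_exp.tendsto _).comp (tl.mul_const ((b : ℂ) / 2))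
  have tc' := tc.congr' (f₂ := fun ε : ℝ => (2 * (r : ℂ) + 1 - (μ + ε * Complex.I)) ^ ((b : ℂ) / 2))
    (by
      have hne : ∀ᶠ ε : ℝ in 𝓝[>] 0, 2 * (r : ℂ) + 1 - (μ + ε * Complex.I) ≠ 0 :=
        (tendsto_const_nhds.sub hT).eventually_ne n2
      filter_upwards [hne] with ε hε
      rw [Complex.cpow_def_of_ne_zero hε]; rfl)
  have t1 : ContinuousAt (fun z : ℂ => (z + 2 * r + 1) ^ ((b : ℂ) / 2)) μ :=
    ContinuousAt.cpow (by fun_prop) continuousAt_const s1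
  have t3 : ContinuousAt (fun z : ℂ => (z - 1) ^ (((a : ℂ) + b) / 2)) μ :=
    ContinuousAt.cpow (by fun_prop) continuousAt_const s3
  have t4 : ContinuousAt (fun z : ℂ => (z + 1) ^ (((a : ℂ) + b) / 2)) μ :=
    ContinuousAt.cpow (by fun_prop) continuousAt_const s4
  exact upperValue_g_sq_of_tendsto (Complex.slitPlane_ne_zero s3) (Complex.slitPlane_ne_zero s4)
    (((t1.tendsto.comp hT).mul tc').div ((t4.tendsto.comp hT).mul (t3.tendsto.comp hT)) hd)

/-- Doubling the hypothesis gives `2 arg w - arg v ≡ π` modulo `2π`. -/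
theorem sq_mul_conj_eq_of_arg_eq {v w : ℂ} {k : ℤ}
    (h : -(1 / 2) * v.arg + w.arg = Real.pi / 2 + k * Real.pi) :
    w ^ 2 * (starRingEnd ℂ) v = -((‖w‖ ^ 2 * ‖v‖ : ℝ) : ℂ) := by
  have hv := Complex.norm_mul_exp_arg_mul_I v
  have hw := Complex.norm_mul_exp_arg_mul_I w
  have hv' : (starRingEnd ℂ) v = ‖v‖ * Complex.exp (-(v.arg * Complex.I)) := by
    conv_lhs => rw [← hv]
    rw [map_mul, Complex.conj_ofReal, ← Complex.exp_conj, map_mul, Complex.conj_ofReal,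
      Complex.conj_I, mul_neg]
  have h2 : Complex.exp (w.arg * Complex.I) ^ 2 * Complex.exp (-(v.arg * Complex.I)) = -1 := by
    rw [← Complex.exp_nat_mul, ← Complex.exp_add]
    have h3 : ((2 : ℕ) : ℂ) * (w.arg * Complex.I) + -(v.arg * Complex.I) =
        Real.pi * Complex.I + k * (2 * Real.pi * Complex.I) := by
      have h4 : (-(1 / 2) * (v.arg : ℂ) + w.arg) = Real.pi / 2 + k * Real.pi := by
        have := congrArg (fun x : ℝ => (x : ℂ)) h
        push_cast at this
        exact this
      push_cast
      linear_combination (2 * Complex.I) * h4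
    rw [h3, Complex.exp_add, Complex.exp_pi_mul_I, Complex.exp_int_mul_two_pi_mul_I, mul_one]
  calc w ^ 2 * (starRingEnd ℂ) v
      = (‖w‖ * Complex.exp (w.arg * Complex.I)) ^ 2 *
        (‖v‖ * Complex.exp (-(v.arg * Complex.I))) := by rw [hw, hv']
    _ = ((‖w‖ : ℂ) ^ 2 * ‖v‖) *
        (Complex.exp (w.arg * Complex.I) ^ 2 * Complex.exp (-(v.arg * Complex.I))) := by ring
    _ = _ := by rw [h2]; push_cast; ring

/-- The expression whose sign, when real, decides the phase at the saddle point with disc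
coordinate `u`. -/
noncomputable def phaseTest (M b : ℕ) (ζ : ℂ) (α : ℝ) (u : ℂ) : ℂ :=
  ζ * u ^ M * (1 - α * u) ^ (2 * b + 2) * (1 - u) ^ (2 * (M - 1) * b) *
    (starRingEnd ℂ) ((1 - u) ^ 2 * (M * ζ * u ^ (M - 1) * (1 - α * u) ^ 2 - (1 - (α : ℂ) ^ 2)))

theorem toHalfPlane_ne_one {u : ℂ} (hu : ‖u‖ < 1) (hu0 : u ≠ 0) : toHalfPlane u - 1 ≠ 0 := by
  intro h
  have := toHalfPlane_sub_one hu
  rw [h, zero_mul, eq_comm] at this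
  exact hu0 ((mul_eq_zero.mp this).resolve_left two_ne_zero)

section

variable {M : ℕ} {ζ u : ℂ}

theorem center_sub_toHalfPlane_ne_zero (hr : 0 < r) (hζ : ‖ζ‖ = 1) (hM : M ≠ 0)
    (hu : IsDiscRoot M ζ (r / (r + 1)) u) : 2 * (r : ℂ) + 1 - toHalfPlane u ≠ 0 := by
  intro h
  have h1 := toHalfPlane_sub_center hu.1 hr
  have h2 : toHalfPlane u - (2 * r + 1) = 0 := by linear_combination -h
  have h3 : (r : ℂ) + 1 ≠ 0 := by exact_mod_cast (by linarith : r + 1 ≠ 0)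
  rw [h2, zero_mul, hu.2] at h1
  have h4 := hu.ne_zero_of_ne (div_add_one_mem hr).1.ne' hM
  have h5 := hu.one_sub_ne_zero (abs_div_add_one_lt_one hr)
  have h6 : ζ ≠ 0 := by rintro rfl; simp at hζ
  exact mul_ne_zero (mul_ne_zero two_ne_zero h3)
    (mul_ne_zero (mul_ne_zero h6 (pow_ne_zero M h4)) h5) h1.symm

theorem center_add_toHalfPlane_ne_zero (hr : 0 < r) (hu : ‖u‖ < 1) :
    toHalfPlane u + 2 * r + 1 ≠ 0 := by
  intro h
  have h1 := congrArg Complex.re h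
  have h2 := re_toHalfPlane_pos hu
  simp at h1
  linarith

/-- The saddle equation replaces `u - α`, and `1 / (r + 1) = 1 - α` removes `r`. The numerator then
contains the factor of `derivative_ne_zero`. -/
theorem fSecond_toHalfPlane (hab : a + b = M * b) (hM : 2 ≤ M) (hr : 0 < r) (hζ : ‖ζ‖ = 1)
    (hu : IsDiscRoot M ζ (r / (r + 1)) u) :
    fSecond a b r (toHalfPlane u) = (b / 2) * ((1 - u) ^ 2 *
      (M * ζ * u ^ (M - 1) * (1 - ((r / (r + 1) : ℝ) : ℂ) * u) ^ 2
        - (1 - ((r / (r + 1) : ℝ) : ℂ) ^ 2))) /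
      (ζ * u ^ M * (1 - ((r / (r + 1) : ℝ) : ℂ) * u) ^ 2) := by
  have hu0 := hu.ne_zero_of_ne (div_add_one_mem hr).1.ne' (by omega)
  have hd := one_sub_ne_zero_of_norm_lt_one hu.1
  have hr1 : (r : ℂ) + 1 ≠ 0 := by exact_mod_cast (by linarith : r + 1 ≠ 0)
  have hα := hu.one_sub_ne_zero (abs_div_add_one_lt_one hr)
  have hζ0 : ζ ≠ 0 := by rintro rfl; simp at hζ
  have hz1 := toHalfPlane_ne_one hu.1 hu0
  have hz2 := add_one_ne_zero_of_re_pos (re_toHalfPlane_pos hu.1)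
  have hz3 := center_add_toHalfPlane_ne_zero hr hu.1
  have hz4 := center_sub_toHalfPlane_ne_zero hr hζ (by omega) hu
  have e1 := toHalfPlane_sub_center hu.1 hr
  have e2 := toHalfPlane_add_center hu.1 hr
  have e3 := toHalfPlane_sub_one hu.1
  have e4 := toHalfPlane_add_one hu.1
  have hroot := hu.2
  have hαr : ((r / (r + 1) : ℝ) : ℂ) * (r + 1) = r := by push_cast; field_simp
  set α : ℂ := ((r / (r + 1) : ℝ) : ℂ)
  set z := toHalfPlane u
  have f1 : z + 2 * r + 1 = 2 * (r + 1) * (1 - α * u) / (1 - u) := by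
    rw [eq_div_iff hd]; linear_combination e2
  have f2 : 2 * r + 1 - z = -(2 * (r + 1) * (ζ * u ^ M * (1 - α * u))) / (1 - u) := by
    rw [eq_div_iff hd]; linear_combination -e1 - 2 * (r + 1) * hroot
  have f3 : z - 1 = 2 * u / (1 - u) := by rw [eq_div_iff hd, e3]
  have f4 : z + 1 = 2 / (1 - u) := by rw [eq_div_iff hd, e4]
  have hab' : (a : ℂ) + b = M * b := by exact_mod_cast hab
  have hpow : u ^ M = u ^ (M - 1) * u := by rw [← pow_succ]; congr 1; omega
  have hup : u ^ (M - 1) ≠ 0 := pow_ne_zero _ hu0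
  have hrα : ((r : ℂ) + 1)⁻¹ = 1 - α := by
    apply inv_eq_of_mul_eq_one_right
    linear_combination -hαr
  have g1 : (b : ℂ) / (z + 2 * r + 1) = b / 2 * (1 - α) * (1 - u) / (1 - α * u) := by
    rw [f1, ← hrα]; field_simp
  have g2 : (b : ℂ) / (2 * r + 1 - z) =
      -(b / 2 * (1 - α) * (1 - u) / (ζ * (u ^ (M - 1) * u) * (1 - α * u))) := by
    rw [f2, ← hrα, hpow]; field_simp
  rw [fSecond, g1, g2, f3, f4, hab']
  rw [hpow] at hroot ⊢
  set p := u ^ (M - 1)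
  field_simp
  linear_combination (-b * (1 - α)) * hroot

/-- Raising to the power `b` removes `ζ`, the factor `u ^ (M * b)` cancels, and oddness of `b`
produces the minus sign. -/
theorem gSquare_toHalfPlane (hab : a + b = M * b) (hM : 2 ≤ M) (hb : Odd b) (hr : 0 < r)
    (hζ : ζ ^ b = 1) (hu : IsDiscRoot M ζ (r / (r + 1)) u) :
    gSquare a b r (toHalfPlane u) = -((((2 * (r + 1)) ^ (2 * b) / 4 ^ (M * b) : ℝ) : ℂ) *
      ((1 - ((r / (r + 1) : ℝ) : ℂ) * u) ^ (2 * b) * (1 - u) ^ (2 * (M - 1) * b))) := by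
  have hu0 := hu.ne_zero_of_ne (div_add_one_mem hr).1.ne' (by omega)
  have hd := one_sub_ne_zero_of_norm_lt_one hu.1
  have e1 := toHalfPlane_sub_center hu.1 hr
  have e2 := toHalfPlane_add_center hu.1 hr
  have e3 := toHalfPlane_sub_one hu.1
  have e4 := toHalfPlane_add_one hu.1
  have hroot := hu.2
  set α : ℂ := ((r / (r + 1) : ℝ) : ℂ)
  set z := toHalfPlane u
  have f12 : (z + 2 * r + 1) * (2 * r + 1 - z) =
      -(ζ * (u ^ M * ((2 * (r + 1)) ^ 2 * (1 - α * u) ^ 2)) / (1 - u) ^ 2) := by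
    rw [← neg_div, eq_div_iff (pow_ne_zero 2 hd)]
    rw [hroot] at e1
    linear_combination (-(z + 2 * r + 1) * (1 - u)) * e1 -
      (2 * (r + 1) * (ζ * u ^ M * (1 - α * u))) * e2
  have f34 : (z + 1) * (z - 1) = 4 * u / (1 - u) ^ 2 := by
    rw [eq_div_iff (pow_ne_zero 2 hd)]
    linear_combination ((z - 1) * (1 - u)) * e4 + 2 * e3
  have hnum : (ζ * (u ^ M * ((2 * ((r : ℂ) + 1)) ^ 2 * (1 - α * u) ^ 2))) ^ b =
      u ^ (M * b) * ((2 * (r + 1)) ^ (2 * b) * (1 - α * u) ^ (2 * b)) := by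
    rw [mul_pow, hζ, one_mul, mul_pow, mul_pow, ← pow_mul, ← pow_mul, ← pow_mul]
  rw [gSquare, ← mul_pow, ← mul_pow, f12, f34, hab, hb.neg_pow, div_pow, hnum, div_pow, mul_pow,
    ← pow_mul (1 - u), ← pow_mul (1 - u)]
  have hexp : (1 - u) ^ (2 * (M * b)) = (1 - u) ^ (2 * b) * (1 - u) ^ (2 * (M - 1) * b) := by
    rw [← pow_add]; congr 1
    obtain ⟨N, rfl⟩ : ∃ N, M = N + 1 := ⟨M - 1, by omega⟩
    simp; ring
  have h1 : u ^ (M * b) ≠ 0 := pow_ne_zero _ hu0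
  have h2 : (1 - u) ^ (2 * b) ≠ 0 := pow_ne_zero _ hd
  have h3 : (1 - u) ^ (2 * (M - 1) * b) ≠ 0 := pow_ne_zero _ hd
  rw [hexp, mul_pow 4 u]
  push_cast
  field_simp
  rw [mul_pow ((r : ℂ) + 1) 2]
  ring

/-- At a saddle point, `g ^ 2 * conj f''` is a negative multiple of `phaseTest`. -/
theorem gSquare_mul_conj_fSecond (hab : a + b = M * b) (hM : 2 ≤ M) (hb : Odd b) (hr : 0 < r)
    (hζ : ζ ^ b = 1) (hu : IsDiscRoot M ζ (r / (r + 1)) u) :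
    ∃ K : ℝ, 0 < K ∧ gSquare a b r (toHalfPlane u) *
      (starRingEnd ℂ) (fSecond a b r (toHalfPlane u)) =
        -(K * phaseTest M b ζ (r / (r + 1)) u) := by
  have hn := norm_eq_one_of_pow_eq_one hb.pos.ne' hζ
  have hu0 := hu.ne_zero_of_ne (div_add_one_mem hr).1.ne' (by omega)
  have hα := hu.one_sub_ne_zero (abs_div_add_one_lt_one hr)
  have hζ0 : ζ ≠ 0 := by rintro rfl; simp at hn
  rw [fSecond_toHalfPlane hab hM hr hn hu, gSquare_toHalfPlane hab hM hb hr hζ hu, phaseTest]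
  set α : ℂ := ((r / (r + 1) : ℝ) : ℂ)
  set w := ζ * u ^ M * (1 - α * u) ^ 2 with hw
  set Y := (1 - u) ^ 2 * (M * ζ * u ^ (M - 1) * (1 - α * u) ^ 2 - (1 - α ^ 2))
  have hw0 : w ≠ 0 := mul_ne_zero (mul_ne_zero hζ0 (pow_ne_zero _ hu0)) (pow_ne_zero _ hα)
  have hb0 : (0 : ℝ) < b := by exact_mod_cast hb.pos
  refine ⟨(2 * (r + 1)) ^ (2 * b) / 4 ^ (M * b) * (b / 2) / ‖w‖ ^ 2, ?_, ?_⟩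
  · have := norm_pos_iff.mpr hw0
    positivity
  · have h1 : ((starRingEnd ℂ) w)⁻¹ = w / (‖w‖ : ℂ) ^ 2 := by
      have h2 : (‖w‖ : ℂ) ≠ 0 := by exact_mod_cast (norm_pos_iff.mpr hw0).ne'
      have h3 : (starRingEnd ℂ) w ≠ 0 := by simpa using hw0
      rw [inv_eq_iff_eq_inv, inv_div, eq_div_iff hw0, mul_comm, Complex.mul_conj']
    have h2 : (1 - α * u) ^ (2 * b + 2) = (1 - α * u) ^ (2 * b) * (1 - α * u) ^ 2 := pow_add _ _ _
    rw [map_div₀, div_eq_mul_inv ((starRingEnd ℂ) ((b : ℂ) / 2 * Y)), h1, h2, map_mul]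
    have h3 : (starRingEnd ℂ) ((b : ℂ) / 2) = b / 2 := by
      rw [map_div₀, map_natCast, map_ofNat]
    rw [h3]
    push_cast
    rw [hw]
    ring

/-- A forbidden phase makes `g ^ 2 * conj f''` a nonpositive real; dividing by `-K` makes
`phaseTest` a nonnegative one. -/
theorem phase_ne_of_not_nonneg (hab : a + b = M * b) (hM : 2 ≤ M) (hb : Odd b) (hr : 0 < r)
    (hζ : ζ ^ b = 1) (hu : IsDiscRoot M ζ (r / (r + 1)) u) (him : 0 ≤ (toHalfPlane u).im)
    (hg : upperValue (g a b r) (toHalfPlane u) ^ 2 = gSquare a b r (toHalfPlane u))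
    (htest : ∀ x : ℝ, 0 ≤ x → phaseTest M b ζ (r / (r + 1)) u ≠ x) (k : ℤ) :
    phase a b r (toHalfPlane u) ≠ Real.pi / 2 + (k : ℝ) * Real.pi := by
  intro h
  have hn := norm_eq_one_of_pow_eq_one hb.pos.ne' hζ
  have hu0 := hu.ne_zero_of_ne (div_add_one_mem hr).1.ne' (by omega)
  have hf := upperValue_deriv_deriv_f (a := a) (b := b) (r := r) him
    (center_add_toHalfPlane_ne_zero hr hu.1)
    (center_sub_toHalfPlane_ne_zero hr hn (by omega) hu) (toHalfPlane_ne_one hu.1 hu0)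
    (add_one_ne_zero_of_re_pos (re_toHalfPlane_pos hu.1))
  rw [phase, hf] at h
  have h1 := sq_mul_conj_eq_of_arg_eq h
  obtain ⟨K, hK, hK2⟩ := gSquare_mul_conj_fSecond hab hM hb hr hζ hu
  rw [hg, hK2, neg_inj] at h1
  refine htest (‖upperValue (g a b r) (toHalfPlane u)‖ ^ 2 *
    ‖fSecond a b r (toHalfPlane u)‖ / K) ?_ ?_
  · positivity
  · have hK' : (K : ℂ) ≠ 0 := by exact_mod_cast hK.ne'
    push_cast at h1 ⊢
    rw [eq_div_iff hK', mul_comm, h1]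

end

end

/-! ### Finiteness of the exceptional parameters -/

section

variable {M b : ℕ} {ζ : ℂ}

theorem analyticAt_phaseTest (hM : 2 ≤ M) (hζ : ‖ζ‖ = 1) {α : ℝ} (hα : |α| < paramRadius M) :
    AnalyticAt ℝ (fun t : ℝ => (phaseTest M b ζ t (discRoot M ζ t)).im) α := by
  have hU := analyticAt_discRoot hM hζ hα
  have hα' : AnalyticAt ℝ (fun t : ℝ => (t : ℂ)) α := Complex.ofRealCLM.analyticAt α
  have hinner : AnalyticAt ℝ (fun t : ℝ => (1 - discRoot M ζ t) ^ 2 *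
      (M * ζ * discRoot M ζ t ^ (M - 1) * (1 - t * discRoot M ζ t) ^ 2 - (1 - (t : ℂ) ^ 2))) α := by
    fun_prop
  have hconj : AnalyticAt ℝ (fun t : ℝ => (starRingEnd ℂ) ((1 - discRoot M ζ t) ^ 2 *
      (M * ζ * discRoot M ζ t ^ (M - 1) * (1 - t * discRoot M ζ t) ^ 2 - (1 - (t : ℂ) ^ 2)))) α :=
    (Complex.conjCLE.toContinuousLinearMap.analyticAt _).comp hinner
  have hall : AnalyticAt ℝ (fun t : ℝ => phaseTest M b ζ t (discRoot M ζ t)) α := by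
    unfold phaseTest
    fun_prop
  exact (Complex.imCLM.analyticAt _).comp hall

/-- As `t → 0` the factor `u ^ M` contributes `t ^ M`, the conjugated factor tends to `-1`, and the
other powers tend to `1`. -/
theorem tendsto_phaseTest_div (hM : 2 ≤ M) (hζ : ‖ζ‖ = 1) :
    Tendsto (fun t : ℝ => (phaseTest M b ζ t (discRoot M ζ t)).im / t ^ M) (𝓝[≠] 0)
      (𝓝 (-ζ.im)) := by
  have hU := tendsto_discRoot hM hζ
  have ht := tendsto_ofReal_nhdsNE
  have h1 := tendsto_const_nhds (x := (1 : ℂ)) (f := 𝓝[≠] (0 : ℝ))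
  have hY : Tendsto (fun t : ℝ => (starRingEnd ℂ) ((1 - discRoot M ζ t) ^ 2 *
      (M * ζ * discRoot M ζ t ^ (M - 1) * (1 - t * discRoot M ζ t) ^ 2 - (1 - (t : ℂ) ^ 2))))
      (𝓝[≠] 0) (𝓝 (-1)) := by
    have := (Complex.continuous_conj.tendsto _).comp (((h1.sub hU).pow 2).mul
      ((((hU.pow (M - 1)).const_mul (M * ζ)).mul ((h1.sub (ht.mul hU)).pow 2)).sub
        (h1.sub (ht.pow 2))))
    refine Eq.subst (motive := fun x => Tendsto _ _ (𝓝 x)) ?_ this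
    simp [show M - 1 ≠ 0 by omega]
  have hlim := ((((tendsto_discRoot_pow_div hM hζ).const_mul ζ).mul
    ((h1.sub (ht.mul hU)).pow (2 * b + 2))).mul ((h1.sub hU).pow (2 * (M - 1) * b))).mul hY
  simp only [mul_one, mul_zero, sub_zero, one_pow, mul_neg] at hlim
  have him := (Complex.continuous_im.tendsto _).comp hlim
  rw [Complex.neg_im] at him
  refine him.congr fun t => ?_
  rw [← Complex.div_ofReal_im, phaseTest]
  simp only [Function.comp]
  push_cast
  congr 1
  ring

theorem finite_phaseTest_zeros {B : ℝ} (hM : 2 ≤ M) (hζ : ‖ζ‖ = 1) (him : ζ.im ≠ 0)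
    (hB : B < paramRadius M) :
    {t ∈ Set.Icc 0 B | (phaseTest M b ζ t (discRoot M ζ t)).im = 0}.Finite :=
  finite_zeros_of_tendsto_div_pow M (fun _ ht => analyticAt_phaseTest hM hζ ht)
    (paramRadius_pos hM) hB (tendsto_phaseTest_div hM hζ) (neg_ne_zero.mpr him)

/-- The common term `toHalfPlane t` cancels, leaving a nonzero coefficient `2 (Re ζ - Re ζ')` at
order `M`. -/
theorem finite_re_eq {B : ℝ} {ζ' : ℂ} (hM : 2 ≤ M) (hζ : ‖ζ‖ = 1) (hζ' : ‖ζ'‖ = 1)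
    (hre : ζ.re ≠ ζ'.re) (hB : B < paramRadius M) :
    {t ∈ Set.Icc 0 B |
      (toHalfPlane (discRoot M ζ t)).re - (toHalfPlane (discRoot M ζ' t)).re = 0}.Finite := by
  have han : ∀ ζ : ℂ, ‖ζ‖ = 1 → ∀ t, |t| < paramRadius M →
      AnalyticAt ℝ (fun t => (toHalfPlane (discRoot M ζ t)).re) t := by
    intro ζ hζ t ht
    have hU := analyticAt_discRoot hM hζ ht
    have hd := one_sub_ne_zero_of_norm_lt_one (isDiscRoot_discRoot hM hζ ht).1
    have hall : AnalyticAt ℝ (fun t => toHalfPlane (discRoot M ζ t)) t := by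
      unfold toHalfPlane
      fun_prop (disch := assumption)
    exact (Complex.reCLM.analyticAt _).comp hall
  refine finite_zeros_of_tendsto_div_pow (L := 2 * ζ.re - 2 * ζ'.re) M
    (fun t ht => (han ζ hζ t ht).sub (han ζ' hζ' t ht)) (paramRadius_pos hM) hB ?_
    (fun h => hre (by linarith))
  have h := (Complex.continuous_re.tendsto _).comp
    ((tendsto_toHalfPlane_sub_div hM hζ).sub (tendsto_toHalfPlane_sub_div hM hζ'))
  have e : (2 * ζ - 2 * ζ').re = 2 * ζ.re - 2 * ζ'.re := by simp
  rw [e] at h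
  refine h.congr fun t => ?_
  simp only [Function.comp]
  rw [← sub_div, sub_sub_sub_cancel_right, ← Complex.ofReal_pow, Complex.div_ofReal_re,
    Complex.sub_re]

/-- A parameter is generic if at it the numbers that decide the phases are not real and the
saddle points have different real parts. -/
def IsGeneric (M b : ℕ) (α : ℝ) : Prop :=
  (∀ ζ : ℂ, ζ ^ b = 1 → ζ.im ≠ 0 → (phaseTest M b ζ α (discRoot M ζ α)).im ≠ 0) ∧
    ∀ ζ ζ' : ℂ, ζ ^ b = 1 → ζ' ^ b = 1 → ζ.re ≠ ζ'.re →
      (toHalfPlane (discRoot M ζ α)).re ≠ (toHalfPlane (discRoot M ζ' α)).re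

theorem finite_not_isGeneric {B : ℝ} (hM : 2 ≤ M) (hb : 0 < b) (hB : B < paramRadius M) :
    {t ∈ Set.Icc 0 B | ¬ IsGeneric M b t}.Finite := by
  have hfin : {ζ : ℂ | ζ ^ b = 1}.Finite :=
    (nthRootsFinset b (1 : ℂ)).finite_toSet.subset fun ζ h => by
      simpa [mem_nthRootsFinset hb] using h
  have hn : ∀ ζ : ℂ, ζ ^ b = 1 → ‖ζ‖ = 1 := fun ζ => norm_eq_one_of_pow_eq_one hb.ne'
  have h1 : (⋃ ζ ∈ {ζ : ℂ | ζ ^ b = 1}, ⋃ _ : ζ.im ≠ 0,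
      {t ∈ Set.Icc 0 B | (phaseTest M b ζ t (discRoot M ζ t)).im = 0}).Finite :=
    hfin.biUnion fun ζ h => Set.finite_iUnion fun him => finite_phaseTest_zeros hM (hn ζ h) him hB
  have h2 : (⋃ ζ ∈ {ζ : ℂ | ζ ^ b = 1}, ⋃ ζ' ∈ {ζ : ℂ | ζ ^ b = 1}, ⋃ _ : ζ.re ≠ ζ'.re,
      {t ∈ Set.Icc 0 B |
        (toHalfPlane (discRoot M ζ t)).re - (toHalfPlane (discRoot M ζ' t)).re = 0}).Finite :=
    hfin.biUnion fun ζ h => hfin.biUnion fun ζ' h' => Set.finite_iUnion fun hre =>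
      finite_re_eq hM (hn ζ h) (hn ζ' h') hre hB
  refine (h1.union h2).subset ?_
  rintro t ⟨ht, hgen⟩
  rw [IsGeneric, not_and_or] at hgen
  push Not at hgen
  rcases hgen with ⟨ζ, hζ, him, h0⟩ | ⟨ζ, ζ', hζ, hζ', hre, h0⟩
  · refine Or.inl ?_
    simp only [Set.mem_iUnion]
    exact ⟨ζ, hζ, him, ht, h0⟩
  · refine Or.inr ?_
    simp only [Set.mem_iUnion]
    exact ⟨ζ, hζ, ζ', hζ', hre, ht, sub_eq_zero.mpr h0⟩

end

/-! ### Listing the saddles and excluding the forbidden phase -/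

section

variable {a b M : ℕ} {r : ℝ}

/-- A finite set of `n` complex numbers with different real parts can be listed by increasing
real part. -/
theorem exists_strictMono_listing (S : Finset ℂ) (hS : Set.InjOn Complex.re S) :
    ∃ e : Fin S.card → ℂ, StrictMono (fun i => (e i).re) ∧ Set.range e = S := by
  classical
  have hcard : (S.image Complex.re).card = S.card := Finset.card_image_of_injOn hS
  set o := (S.image Complex.re).orderEmbOfFin hcard with ho
  have hmem : ∀ i, ∃ z ∈ S, z.re = o i := fun i =>
    Finset.mem_image.mp ((S.image Complex.re).orderEmbOfFin_mem hcard i)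
  choose e he hre using hmem
  refine ⟨e, fun i j hij => ?_, Set.Subset.antisymm ?_ ?_⟩
  · simp only [hre]; exact o.strictMono hij
  · rintro _ ⟨i, rfl⟩; exact he i
  · intro z hz
    have h1 : z.re ∈ Set.range o := by
      rw [ho, Finset.range_orderEmbOfFin]
      exact_mod_cast Finset.mem_image_of_mem _ hz
    obtain ⟨i, hi⟩ := h1
    exact ⟨i, hS (he i) hz ((hre i).trans hi)⟩

theorem isRoot_Q_upper_iff (hab : a + b = M * b) (hb : Odd b) (hM : 2 ≤ M) (hr : 0 < r)
    (hr1 : |r / (r + 1)| < paramRadius M) (z : ℂ) :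
    (0 < z.re ∧ 0 < z.im ∧ (Q a b r).IsRoot z) ↔ ∃ ζ ∈ upperUnits M b r, z = saddle M r ζ := by
  constructor
  · rintro ⟨h1, h2, h3⟩
    obtain ⟨ζ, hζ, rfl⟩ := (isRoot_Q_iff_exists_saddle hab hb.pos.ne' hM hr hr1 h1).mp h3
    exact ⟨ζ, (mem_upperUnits hb.pos).mpr ⟨hζ, h2⟩, rfl⟩
  · rintro ⟨ζ, hζ, rfl⟩
    obtain ⟨h1, h2⟩ := (mem_upperUnits hb.pos).mp hζ
    have hpos := re_saddle_pos hM hr1 (norm_eq_one_of_pow_eq_one hb.pos.ne' h1)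
    exact ⟨hpos, h2, (isRoot_Q_iff_exists_saddle hab hb.pos.ne' hM hr hr1 hpos).mpr ⟨ζ, h1, rfl⟩⟩

theorem existsUnique_real_root (hab : a + b = M * b) (hb : Odd b) (hM : 2 ≤ M) (hMe : Even M)
    (hr : 0 < r) (hr1 : |r / (r + 1)| < paramRadius M) :
    ∃ μ : ℝ, 2 * r + 1 < μ ∧ (Q a b r).IsRoot (μ : ℂ) ∧
      (∀ ν : ℝ, 2 * r + 1 < ν → (Q a b r).IsRoot (ν : ℂ) → ν = μ) ∧ saddle M r 1 = μ := by
  obtain ⟨μ, hμ, hs⟩ := exists_real_saddle hM hMe hr hr1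
  refine ⟨μ, hμ, ?_, ?_, hs⟩
  · exact (isRoot_Q_iff_exists_saddle hab hb.pos.ne' hM hr hr1
      (by rw [Complex.ofReal_re]; linarith)).mpr ⟨1, one_pow _, hs.symm⟩
  · intro ν hν hroot
    obtain ⟨ζ, hζ, h⟩ := (isRoot_Q_iff_exists_saddle hab hb.pos.ne' hM hr hr1
      (by rw [Complex.ofReal_re]; linarith)).mp hroot
    have h1 : ζ = 1 := by
      by_contra hne
      refine im_saddle_ne_zero hM hr hr1 (norm_eq_one_of_pow_eq_one hb.pos.ne' hζ)
        (conj_ne_self hb hζ hne) ?_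
      rw [← h, Complex.ofReal_im]
    rw [h1, hs] at h
    exact_mod_cast h

theorem mem_oddUpTo {b l : ℕ} : l ∈ oddUpTo b ↔ (1 ≤ l ∧ l ≤ b) ∧ Odd l := by
  rw [oddUpTo, Finset.mem_filter, Finset.mem_Icc]

theorem exists_isSaddleFamily (hab : a + b = M * b) (hb : Odd b) (hM : 2 ≤ M) (hMe : Even M)
    (hr : 0 < r) (hr1 : |r / (r + 1)| < paramRadius M) (hgen : IsGeneric M b (r / (r + 1))) :
    ∃ ρ : ℕ → ℂ, IsSaddleFamily a b r ρ ∧ ρ b = saddle M r 1 ∧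
      ∀ l ∈ oddUpTo b, l < b → ∃ ζ ∈ upperUnits M b r, ρ l = saddle M r ζ := by
  classical
  set S := (upperUnits M b r).image (saddle M r) with hS
  have hnorm : ∀ ζ ∈ upperUnits M b r, ζ ^ b = 1 := fun ζ h => ((mem_upperUnits hb.pos).mp h).1
  have hcard : 2 * S.card + 1 = b := by
    rw [hS, Finset.card_image_of_injOn, card_upperUnits hM hMe hb hr hr1]
    intro ζ h ζ' h' heq
    exact saddle_injOn hM hr hr1 (norm_eq_one_of_pow_eq_one hb.pos.ne' (hnorm ζ h))
      (norm_eq_one_of_pow_eq_one hb.pos.ne' (hnorm ζ' h')) heq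
  have hinj : Set.InjOn Complex.re S := by
    intro z hz z' hz' heq
    obtain ⟨ζ, h, rfl⟩ := Finset.mem_image.mp (Finset.mem_coe.mp hz)
    obtain ⟨ζ', h', rfl⟩ := Finset.mem_image.mp (Finset.mem_coe.mp hz')
    by_contra hne
    have hne' : ζ ≠ ζ' := fun h => hne (by rw [h])
    exact hgen.2 ζ ζ' (hnorm ζ h) (hnorm ζ' h')
      (re_ne_of_mem_upperUnits hM hb.pos hr1 h h' hne') heq
  obtain ⟨e, hmono, hrange⟩ := exists_strictMono_listing S hinj
  -- An odd `l = 2i + 1` has `l / 2 = i`. Since `S.card = (b - 1) / 2`, the index `b` is the first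
  -- odd one to fall into the default branch, the real saddle.
  set ρ : ℕ → ℂ := fun l => if h : l / 2 < S.card then e ⟨l / 2, h⟩ else saddle M r 1 with hρ
  have hlt : ∀ {l}, l ∈ oddUpTo b → l < b → l / 2 < S.card := by
    intro l hl h
    obtain ⟨k, rfl⟩ := (mem_oddUpTo.mp hl).2
    omega
  have hρb : ρ b = saddle M r 1 := by
    rw [hρ]; exact dif_neg (by omega)
  have himage : ρ '' {l | l ∈ oddUpTo b ∧ l < b} = S := by
    rw [← hrange]
    ext z
    constructor
    · rintro ⟨l, ⟨hl, hlb⟩, rfl⟩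
      exact ⟨⟨l / 2, hlt hl hlb⟩, by simp only [hρ]; rw [dif_pos (hlt hl hlb)]⟩
    · rintro ⟨i, rfl⟩
      have hi := i.2
      refine ⟨2 * i + 1, ⟨mem_oddUpTo.mpr ⟨⟨by omega, by omega⟩, ⟨i, rfl⟩⟩, by omega⟩, ?_⟩
      have h2 : (2 * (i : ℕ) + 1) / 2 = i := by omega
      simp only [hρ, h2]
      rw [dif_pos hi]
  refine ⟨ρ, ⟨?_, ?_, ?_⟩, hρb, ?_⟩
  · rintro l ⟨hl, hlb⟩ l' ⟨hl', hlb'⟩ hll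
    simp only [hρ]
    rw [dif_pos (hlt hl hlb), dif_pos (hlt hl' hlb')]
    apply hmono
    rw [Fin.mk_lt_mk]
    obtain ⟨k, rfl⟩ := (mem_oddUpTo.mp hl).2
    obtain ⟨k', rfl⟩ := (mem_oddUpTo.mp hl').2
    omega
  · rw [himage]
    ext z
    rw [Set.mem_ofPred_eq, isRoot_Q_upper_iff hab hb hM hr hr1, hS, Finset.mem_coe,
      Finset.mem_image]
    exact exists_congr fun ζ => and_congr_right fun _ => eq_comm
  · obtain ⟨μ, h1, h2, h3, h4⟩ := existsUnique_real_root hab hb hM hMe hr hr1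
    exact ⟨μ, h1, h2, h3, hρb.trans h4⟩
  · intro l hl hlb
    have h : ρ l ∈ (S : Set ℂ) := himage ▸ ⟨l, ⟨hl, hlb⟩, rfl⟩
    obtain ⟨ζ, hζ, h2⟩ := Finset.mem_image.mp (Finset.mem_coe.mp h)
    exact ⟨ζ, hζ, h2.symm⟩

theorem phase_saddle_ne (hab : a + b = M * b) (hb : Odd b) (hM : 2 ≤ M) (hMe : Even M) (hr : 0 < r)
    (hr1 : |r / (r + 1)| < paramRadius M) (hgen : IsGeneric M b (r / (r + 1))) {ζ : ℂ}
    (hζ : ζ ∈ upperUnits M b r) (k : ℤ) :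
    phase a b r (saddle M r ζ) ≠ Real.pi / 2 + (k : ℝ) * Real.pi := by
  obtain ⟨h1, him⟩ := (mem_upperUnits hb.pos).mp hζ
  have hn := norm_eq_one_of_pow_eq_one hb.pos.ne' h1
  have hne : ζ ≠ 1 := by
    rintro rfl
    obtain ⟨μ, -, hμ⟩ := exists_real_saddle hM hMe hr hr1
    rw [hμ, Complex.ofReal_im] at him
    exact lt_irrefl _ him
  refine phase_ne_of_not_nonneg hab hM hb hr h1 (isDiscRoot_discRoot hM hn hr1) him.le
    (upperValue_g_sq_of_im_pos him) (fun x _ hx => ?_) k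
  refine hgen.1 ζ h1 (conj_ne_self hb h1 hne) ?_
  rw [hx, Complex.ofReal_im]

/-- Here `u = x` is real with `α < x < 1`, so every factor of `phaseTest` is positive except the
last, which `norm_lt` makes negative. No genericity is needed. -/
theorem phase_real_saddle_ne (hab : a + b = M * b) (hb : Odd b) (hM : 2 ≤ M) (hMe : Even M)
    (hr : 0 < r) (hr1 : |r / (r + 1)| < paramRadius M) (k : ℤ) :
    phase a b r (saddle M r 1) ≠ Real.pi / 2 + (k : ℝ) * Real.pi := by
  have hroot := isDiscRoot_discRoot hM norm_one hr1
  obtain ⟨x, hx, hx1, hxr⟩ := exists_real_discRoot hM hMe hr hr1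
  obtain ⟨μ, hμ, hs⟩ := exists_real_saddle hM hMe hr hr1
  have hs' : toHalfPlane (discRoot M 1 (r / (r + 1))) = μ := hs
  refine phase_ne_of_not_nonneg hab hM hb hr (one_pow b) hroot
    (by rw [hs', Complex.ofReal_im]) (by rw [hs']; exact upperValue_g_sq_of_real hr hμ)
    (fun y hy h => ?_) k
  have hnorm := hroot.norm_lt hM norm_one (abs_lt_one_of_abs_lt hr1)
  rw [hxr] at h hnorm
  set α := r / (r + 1)
  have hα := div_add_one_mem hr
  have hx0 : 0 < x := hα.1.trans hx
  have hαx : 0 < 1 - α * x := by nlinarith [hα.1, hα.2]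
  have e1 : ‖1 - (α : ℂ) * x‖ = 1 - α * x := by
    rw [← Complex.ofReal_mul, ← Complex.ofReal_one, ← Complex.ofReal_sub, Complex.norm_real,
      Real.norm_of_nonneg hαx.le]
  rw [e1, Complex.norm_real, Real.norm_of_nonneg hx0.le] at hnorm
  have e2 : phaseTest M b 1 α x =
      ((x ^ M * (1 - α * x) ^ (2 * b + 2) * (1 - x) ^ (2 * (M - 1) * b) *
        ((1 - x) ^ 2 * (M * x ^ (M - 1) * (1 - α * x) ^ 2 - (1 - α ^ 2))) : ℝ) : ℂ) := by
    simp [phaseTest]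
  rw [e2] at h
  have h' := Complex.ofReal_injective h
  have hx1' : 0 < 1 - x := by linarith
  have hneg : M * x ^ (M - 1) * (1 - α * x) ^ 2 - (1 - α ^ 2) < 0 := by linarith
  have : (x ^ M * (1 - α * x) ^ (2 * b + 2) * (1 - x) ^ (2 * (M - 1) * b) *
        ((1 - x) ^ 2 * (M * x ^ (M - 1) * (1 - α * x) ^ 2 - (1 - α ^ 2)))) < 0 :=
    mul_neg_of_pos_of_neg (by positivity) (mul_neg_of_pos_of_neg (by positivity) hneg)
  linarith

end

end SaddlePhase

theorem mainTheorem9 (a b : ℕ) (ha : Odd a) (hb : Odd b) (hdvd : b ∣ a) (hab : 5 * b ≤ a) :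
    ∃ R : Finset ℝ, ∀ r : ℝ, 1 ≤ r → r ≤ ((a : ℝ) - 1) / (3 * (b : ℝ)) → r ∉ R →
      ∃ ρ : ℕ → ℂ, SaddlePhase.IsSaddleFamily a b r ρ ∧
        ∀ l ∈ SaddlePhase.oddUpTo b, ∀ k : ℤ,
          SaddlePhase.phase a b r (ρ l) ≠ Real.pi / 2 + (k : ℝ) * Real.pi := by
  open SaddlePhase in
  obtain ⟨m, rfl⟩ := hdvd
  have hb0 : 0 < b := hb.pos
  have hm : Odd m := (Nat.odd_mul.mp ha).2
  have hm5 : 5 ≤ m := by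
    rw [mul_comm 5] at hab
    exact Nat.le_of_mul_le_mul_left hab hb0
  have hsum : b * m + b = (m + 1) * b := by ring
  have hM : 2 ≤ m + 1 := by omega
  have hMe : Even (m + 1) := hm.add_one
  have hbR : (0 : ℝ) < b := by exact_mod_cast hb0
  have hmR : (5 : ℝ) ≤ m := by exact_mod_cast hm5
  set s : ℝ := (((b * m : ℕ) : ℝ) - 1) / (3 * (b : ℝ)) with hs
  -- For `M = m + 1`, the condition `α < paramRadius M` is `r < m / 2`; the bound on `r` is even
  -- below `m / 3`.
  have hs2 : s < m / 2 := by
    rw [hs, div_lt_div_iff₀ (by positivity) two_pos]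
    push_cast
    nlinarith [mul_pos hbR (by linarith : (0 : ℝ) < m)]
  have hs0 : 0 < s + 1 := by
    have : 0 ≤ s := by
      refine div_nonneg ?_ (by positivity)
      have : (1 : ℝ) ≤ ((b * m : ℕ) : ℝ) := by exact_mod_cast ha.pos
      linarith
    linarith
  have hmono : ∀ t : ℝ, 0 < t + 1 → t ≤ s → t / (t + 1) ≤ s / (s + 1) := by
    intro t ht hts
    rw [div_le_div_iff₀ ht hs0]; nlinarith
  have hB : s / (s + 1) < paramRadius (m + 1) := by
    rw [paramRadius, div_lt_div_iff₀ hs0 (by positivity)]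
    push_cast
    nlinarith
  -- The map `t ↦ t / (1 - t)` inverts `r ↦ r / (r + 1)`, carrying exceptional `α` back to
  -- exceptional `r`.
  have hfin := (finite_not_isGeneric hM hb0 hB).image fun t : ℝ => t / (1 - t)
  refine ⟨hfin.toFinset, fun r hr hrs hnot => ?_⟩
  have hr0 : 0 < r := by linarith
  have hα := div_add_one_mem hr0
  have hαB := hmono r (by linarith) hrs
  have hr1 : |r / (r + 1)| < paramRadius (m + 1) := by
    rw [abs_of_pos hα.1]; exact hαB.trans_lt hB
  have hgen : IsGeneric (m + 1) b (r / (r + 1)) := by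
    by_contra h
    apply hnot
    rw [Set.Finite.mem_toFinset]
    refine ⟨r / (r + 1), ⟨⟨hα.1.le, hαB⟩, h⟩, ?_⟩
    have : r + 1 ≠ 0 := by linarith
    field_simp
    ring
  obtain ⟨ρ, hfam, hlast, hrest⟩ := exists_isSaddleFamily hsum hb hM hMe hr0 hr1 hgen
  refine ⟨ρ, hfam, fun l hl k => ?_⟩
  rcases (mem_oddUpTo.mp hl).1.2.lt_or_eq with hlb | rfl
  · obtain ⟨ζ, hζ, h⟩ := hrest l hl hlb
    rw [h]
    exact phase_saddle_ne hsum hb hM hMe hr0 hr1 hgen hζ k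
  · rw [hlast]
    exact phase_real_saddle_ne hsum hb hM hMe hr0 hr1 k
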